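/- Let $g\ge 1$ and let $\mathrm{USp}(2g)$ be the group of complex $2g\times 2g$ matrices that are unitary and preserve the standard symplectic form. For $x\in \mathrm{USp}(2g)$ and $0\le i\le g$ let $a_i(x)$ be $(-1)^i$ times the coefficient of $T^{2g-i}$ in the characteristic polynomial $f_x(T)=\det(T-x)$, so that $f_x(T)=T^{2g}-a_1T^{2g-1}+a_2T^{2g-2}-\cdots-a_1T+1$ and $a_0=1$. Let $e_1,\dots,e_g$ be the standard coordinate weights of the maximal torus of matrices $\operatorname{diag}(z_1,\dots,z_g,z_1^{-1},\dots,z_g^{-1})$, $|z_k|=1$, with simple roots $e_1-e_2,\dots,e_{g-1}-e_g,2e_g$. Put $\varpi_0=0$, and for $1\le i\le g$ let $\varpi_i=e_1+\cdots+e_i$ be the fundamental dominant weights. For $0\le i\le g$ let $\chi_i$ be the character of the irreducible continuous finite-dimensional complex representation of $\mathrm{USp}(2g)$ of highest weight $\varpi_i$ (part of the claim is that such a representation exists and that its character is determined by $\varpi_i$). Then $$\chi_0=a_0,\qquad \chi_1=a_1,\qquad \chi_i=a_i-a_{i-2}\quad\text{for } 2\le i\le g,$$ and for $2\le i\le g$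 the function $\chi_i$ is also the character of $\Lambda^iV$ minus the character of $\Lambda^{i-2}V$, where $V=\mathbb{C}^{2g}$ is the standard representation. -/

import Mathlib

noncomputable section

/-- The unitary symplectic group `USp(2g)`: the complex `2g × 2g` matrices that are unitary and
preserve the standard symplectic form `J`. It carries the topology induced from the matrices. -/
def USp (g : ℕ) : Subgroup (Matrix.unitaryGroup (Fin g ⊕ Fin g) ℂ) where
  carrier := {A | (A : Matrix (Fin g ⊕ Fin g) (Fin g ⊕ Fin g) ℂ) ∈
    Matrix.symplecticGroup (Fin g) ℂ}
  mul_mem' {A B} hA hB := mul_mem (show _ ∈ Matrix.symplecticGroup (Fin g) ℂ from hA) hB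
  one_mem' := one_mem (Matrix.symplecticGroup (Fin g) ℂ)
  inv_mem' {A} hA := by
    have h1 : ((A⁻¹ : Matrix.unitaryGroup (Fin g ⊕ Fin g) ℂ) :
        Matrix (Fin g ⊕ Fin g) (Fin g ⊕ Fin g) ℂ) = (A.1)⁻¹ := by
      refine (Matrix.inv_eq_left_inv ?_).symm
      have h := congrArg Subtype.val (inv_mul_cancel A)
      exact h
    have h2 := SymplecticGroup.coe_inv' (⟨A.1, hA⟩ : Matrix.symplecticGroup (Fin g) ℂ)
    show _ ∈ Matrix.symplecticGroup (Fin g) ℂ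
    rw [h1, ← h2]
    exact Subtype.property _

namespace USp

/-- The underlying complex matrix of an element of `USp(2g)`. -/
def toMatrix {g : ℕ} (x : USp g) : Matrix (Fin g ⊕ Fin g) (Fin g ⊕ Fin g) ℂ := x.1.1

/-- `a i x` is `(-1)^i` times the coefficient of `T^(2g-i)` in the characteristic polynomial
of `x` (used for `i ≤ g` only, where the subtraction does not truncate). -/
def a (g i : ℕ) (x : USp g) : ℂ := (-1) ^ i * (toMatrix x).charpoly.coeff (2 * g - i)

/-- The element `diag(z₁, …, z_g, z₁⁻¹, …, z_g⁻¹)` of the standard maximal torus. -/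
def torus {g : ℕ} (z : Fin g → Circle) : USp g :=
  ⟨⟨Matrix.diagonal (Sum.elim (fun k => (z k : ℂ)) fun k => ((z k)⁻¹ : Circle)), by
      rw [Matrix.mem_unitaryGroup_iff, Matrix.star_eq_conjTranspose,
        Matrix.diagonal_conjTranspose, Matrix.diagonal_mul_diagonal, ← Matrix.diagonal_one]
      congr 1
      funext k
      have h : ∀ w : Circle, (w : ℂ) * star (w : ℂ) = 1 := fun w => by
        rw [Complex.star_def, ← Circle.coe_inv_eq_conj, ← Circle.coe_mul, mul_inv_cancel,
          Circle.coe_one]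
      rcases k with k | k
      · exact h (z k)
      · exact h (z k)⁻¹⟩, by
    show _ ∈ Matrix.symplecticGroup (Fin g) ℂ
    rw [SymplecticGroup.mem_iff, Matrix.diagonal_transpose]
    ext i j
    rw [Matrix.mul_diagonal, Matrix.diagonal_mul]
    rcases i with i | i <;> rcases j with j | j <;>
      simp [Matrix.J, Matrix.one_apply] <;> split_ifs with h <;> simp [h]⟩

/-- Integral weights of the standard torus, in the coordinates `e₁, …, e_g`: the weight `lam` is
the character `diag(z, z⁻¹) ↦ ∏ k, z k ^ lam k`. -/
abbrev Weight (g : ℕ) : Type := Fin g → ℤ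

/-- The simple roots `e₁ - e₂, …, e_{g-1} - e_g, 2 e_g` of `USp(2g)` (indexed from `0`). -/
def simpleRoot {g : ℕ} (k : Fin g) : Weight g := fun j =>
  if j = k then (if k.val + 1 = g then 2 else 1) else if j.val = k.val + 1 then -1 else 0

/-- The simple coroots `e₁ - e₂, …, e_{g-1} - e_g, e_g` of `USp(2g)` (indexed from `0`). -/
def simpleCoroot {g : ℕ} (k : Fin g) : Fin g → ℤ := fun j =>
  if j = k then 1 else if j.val = k.val + 1 then -1 else 0

/-- `ϖ_i = e₁ + ⋯ + e_i`. For `1 ≤ i ≤ g` these are the fundamental dominant weights, and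
`ϖ_0 = 0`. -/
def fundamentalWeight (g i : ℕ) : Weight g := fun j => if j.val < i then 1 else 0

/-- The fundamental weights are dual to the simple coroots. -/
theorem fundamentalWeight_pairing (g : ℕ) (i k : Fin g) :
    fundamentalWeight g (i.val + 1) ⬝ᵥ simpleCoroot k = if i = k then 1 else 0 := by
  have key : ∀ j : Fin g, fundamentalWeight g (i.val + 1) j * simpleCoroot k j =
      (if j = k then (if k ≤ i then 1 else 0) else 0) +
      (if j.val = k.val + 1 then (if k < i then -1 else 0) else 0) := by
    intro j
    simp only [fundamentalWeight, simpleCoroot, Fin.ext_iff, Fin.le_def, Fin.lt_def]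
    split_ifs <;> omega
  simp only [dotProduct, key, Finset.sum_add_distrib, Finset.sum_ite_eq', Finset.mem_univ, if_true]
  have hs : ∑ j : Fin g, (if j.val = k.val + 1 then (if k < i then (-1 : ℤ) else 0) else 0) =
      if k < i then -1 else 0 := by
    by_cases hk : k.val + 1 < g
    · rw [Finset.sum_eq_single (⟨k.val + 1, hk⟩ : Fin g)]
      · simp
      · intro j _ hj
        exact if_neg fun h => hj (Fin.ext h)
      · simp
    · rw [if_neg (by rw [Fin.lt_def]; omega)]
      exact Finset.sum_eq_zero fun j _ => if_neg (by omega)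
  rw [hs]
  simp only [Fin.ext_iff, Fin.le_def, Fin.lt_def]
  split_ifs <;> omega

/-- The dominance order on weights: `lam - mu` is a sum of simple roots. -/
def DominanceLE {g : ℕ} (mu lam : Weight g) : Prop :=
  ∃ c : Fin g → ℕ, lam - mu = ∑ k, c k • simpleRoot k

section Representations

variable {g : ℕ} {V : Type*} [AddCommGroup V] [Module ℂ V]

/-- `lam` occurs as a weight of the representation `ρ`, with respect to the standard torus. -/
def IsWeight (ρ : Representation ℂ (USp g) V) (lam : Weight g) : Prop :=
  ∃ v : V, v ≠ 0 ∧ ∀ z : Fin g → Circle, ρ (torus z) v = (∏ k, (z k : ℂ) ^ lam k) • v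

/-- `ρ` is a continuous irreducible finite-dimensional complex representation of `USp(2g)` with
highest weight `lam`. Continuity is continuity of all matrix coefficients. -/
structure IsIrreducibleOfHighestWeight (ρ : Representation ℂ (USp g) V) (lam : Weight g) :
    Prop where
  finiteDimensional : FiniteDimensional ℂ V
  continuous : ∀ (v : V) (φ : Module.Dual ℂ V), Continuous fun x : USp g => φ (ρ x v)
  irreducible : ρ.IsIrreducible
  isWeight : IsWeight ρ lam
  isHighest : ∀ mu : Weight g, IsWeight ρ mu → DominanceLE mu lam

end Representations

/-- `χ` is the character of an irreducible representation of `USp(2g)` of highest weight `lam`.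
(Every finite-dimensional space is isomorphic to one in `Type`, so this loses nothing.) -/
def IsIrreducibleCharacter (g : ℕ) (lam : Weight g) (χ : USp g → ℂ) : Prop :=
  ∃ (V : Type) (_ : AddCommGroup V) (_ : Module ℂ V) (ρ : Representation ℂ (USp g) V),
    IsIrreducibleOfHighestWeight ρ lam ∧ ρ.character = χ

/-- The standard representation of `USp(2g)` on column vectors `ℂ^(2g)`. -/
def standardRep (g : ℕ) : Representation ℂ (USp g) (Fin g ⊕ Fin g → ℂ) where
  toFun x := Matrix.toLin' (toMatrix x)
  map_one' := Matrix.toLin'_one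
  map_mul' x y := Matrix.toLin'_mul (toMatrix x) (toMatrix y)

/-- The `i`-th exterior power of the standard representation. -/
def exteriorPowerRep (g i : ℕ) : Representation ℂ (USp g) (⋀[ℂ]^i (Fin g ⊕ Fin g → ℂ)) where
  toFun x := exteriorPower.map i (standardRep g x)
  map_one' := by
    rw [map_one]
    exact exteriorPower.map_id
  map_mul' x y := by
    rw [map_mul]
    exact exteriorPower.map_comp (standardRep g y) (standardRep g x)

end USp

end

/-! The plan is to realise `χ_i` inside `Λ^i V` and to pin down every other candidate by
orthogonality of characters. Everything happens on the compact group, without Lie algebras.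

Realisation. A unitary symplectic matrix commutes with the quaternionic structure `v ↦ J v̄`, so it
is conjugate in `USp(2g)` to a torus element (`exists_eq_conj_torus`). Class functions are therefore
determined on the torus, where `a_i` and the character of `Λ^i V` are the same elementary symmetric
polynomial (`a_eq_character`). The symplectic form gives an invariant `ω ∈ Λ²V`. An `sl₂`-type
commutation relation between multiplication by `ω` and its adjoint contraction makes `ω· : Λ^(i-2) →
Λ^i` injective for `i - 2 < g` (`eq_zero_of_extOmega_mul_eq_zero`). By complete reducibility it has
an invariant complement, whose character is `a_i - a_{i-2}`.

Irreducibility. The weight `ϖ_i` has multiplicity one in the complement, and `Λ^i` is generated by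
`ω Λ^(i-2)` together with `e_1 ∧ ⋯ ∧ e_i` (`extProd_mem`). A representation generated by a vector of
a one-dimensional weight space is irreducible, because that vector lies in one of the two summands
of any invariant splitting.

Uniqueness. Let `ρ` be irreducible of highest weight `ϖ_i`. Its weight multiplicities are invariant
under signed permutations and supported below `ϖ_i`, so they live on the orbits of `ϖ_i, ϖ_{i-2},
…`, and the character of `ρ` is a combination of the `a_j` with `j ≤ i`. If it differed from `χ_i`,
it would be orthogonal to every `χ_j`, hence to every `a_j`, hence to itself, although its norm is
one (`character_eq_fundChar`). -/

noncomputable section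

open Module

/-! ### The invariant mean of a compact group -/

section Mean

variable {G : Type*} [Group G] [TopologicalSpace G] [IsTopologicalGroup G] [CompactSpace G]

/-- The normalised Haar integral of a function on a compact group. -/
def haarMean (f : G → ℂ) : ℂ :=
  letI : MeasurableSpace G := borel G
  haveI : BorelSpace G := ⟨rfl⟩
  ∫ x, f x ∂(MeasureTheory.Measure.haarMeasure (⊤ : TopologicalSpace.PositiveCompacts G))

theorem haarMean_const (c : ℂ) : haarMean (fun _ : G => c) = c := by
  let _ : MeasurableSpace G := borel G
  have _ : BorelSpace G := ⟨rfl⟩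
  have h : (MeasureTheory.Measure.haarMeasure (⊤ : TopologicalSpace.PositiveCompacts G))
      Set.univ = 1 := MeasureTheory.Measure.haarMeasure_self
  simp [haarMean, MeasureTheory.measureReal_def, h]

theorem haarMean_add {f h : G → ℂ} (hf : Continuous f) (hh : Continuous h) :
    haarMean (fun x => f x + h x) = haarMean f + haarMean h := by
  let _ : MeasurableSpace G := borel G
  have _ : BorelSpace G := ⟨rfl⟩
  exact MeasureTheory.integral_add
    (hf.integrable_of_hasCompactSupport (HasCompactSupport.of_compactSpace f))
    (hh.integrable_of_hasCompactSupport (HasCompactSupport.of_compactSpace h))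

theorem haarMean_const_mul (c : ℂ) (f : G → ℂ) :
    haarMean (fun x => c * f x) = c * haarMean f := by
  let _ : MeasurableSpace G := borel G
  have _ : BorelSpace G := ⟨rfl⟩
  exact MeasureTheory.integral_const_mul c f

theorem haarMean_sum {ι : Type*} (s : Finset ι) {f : ι → G → ℂ} (hf : ∀ i ∈ s, Continuous (f i)) :
    haarMean (fun x => ∑ i ∈ s, f i x) = ∑ i ∈ s, haarMean (f i) := by
  let _ : MeasurableSpace G := borel G
  have _ : BorelSpace G := ⟨rfl⟩
  exact MeasureTheory.integral_finsetSum _ fun i hi =>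
    (hf i hi).integrable_of_hasCompactSupport (HasCompactSupport.of_compactSpace _)

theorem haarMean_mul_left (f : G → ℂ) (y : G) : haarMean (fun x => f (y * x)) = haarMean f := by
  let _ : MeasurableSpace G := borel G
  have _ : BorelSpace G := ⟨rfl⟩
  exact MeasureTheory.integral_mul_left_eq_self f y

theorem norm_haarMean_le {f : G → ℂ} {C : ℝ} (h : ∀ x, ‖f x‖ ≤ C) : ‖haarMean f‖ ≤ C := by
  let _ : MeasurableSpace G := borel G
  have _ : BorelSpace G := ⟨rfl⟩
  have h1 : (MeasureTheory.Measure.haarMeasure (⊤ : TopologicalSpace.PositiveCompacts G))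
      Set.univ = 1 := MeasureTheory.Measure.haarMeasure_self
  have := MeasureTheory.norm_integral_le_of_norm_le_const
    (μ := MeasureTheory.Measure.haarMeasure (⊤ : TopologicalSpace.PositiveCompacts G))
    (f := f) (C := C) (Filter.Eventually.of_forall h)
  simpa [haarMean, MeasureTheory.measureReal_def, h1] using! this

/-- Haar measure charges every nonempty open set, so a nonzero continuous `|f|²` has positive
integral. -/
theorem eq_zero_of_haarMean_mul_star {f : G → ℂ} (hf : Continuous f)
    (h : haarMean (fun x => f x * star (f x)) = 0) : f = 0 := by
  let _ : MeasurableSpace G := borel G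
  have _ : BorelSpace G := ⟨rfl⟩
  by_contra hne
  obtain ⟨x, hx⟩ := Function.ne_iff.mp hne
  have hc : Continuous fun x => Complex.normSq (f x) := Complex.continuous_normSq.comp hf
  have hpos := hc.integral_pos_of_hasCompactSupport_nonneg_nonzero
    (μ := MeasureTheory.Measure.haarMeasure (⊤ : TopologicalSpace.PositiveCompacts G))
    (HasCompactSupport.of_compactSpace _) (fun x => Complex.normSq_nonneg (f x)) (x := x)
    (by simpa using hx)
  have h2 : haarMean (fun x => f x * star (f x)) =
      ((∫ x, Complex.normSq (f x)
        ∂(MeasureTheory.Measure.haarMeasure (⊤ : TopologicalSpace.PositiveCompacts G)) : ℝ) : ℂ) := by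
    rw [← integral_complex_ofReal]
    simp only [haarMean, Complex.star_def, Complex.mul_conj]
  rw [h2, Complex.ofReal_eq_zero] at h
  exact hpos.ne' h

/-- A weak integral: averaging against functionals gives an element of the bidual, which is `V` in
finite dimension. No topology on `V` is needed. -/
theorem exists_dual_eq_haarMean {V : Type*} [AddCommGroup V] [Module ℂ V] [FiniteDimensional ℂ V]
    (F : G → V) (hF : ∀ φ : Dual ℂ V, Continuous fun x => φ (F x)) :
    ∃ v : V, ∀ φ : Dual ℂ V, φ v = haarMean fun x => φ (F x) := by
  let L : Dual ℂ (Dual ℂ V) :=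
    { toFun := fun φ => haarMean fun x => φ (F x)
      map_add' := fun φ ψ => haarMean_add (hF φ) (hF ψ)
      map_smul' := fun c φ => haarMean_const_mul c fun x => φ (F x) }
  refine ⟨(evalEquiv ℂ V).symm L, fun φ => ?_⟩
  rw [apply_evalEquiv_symm_apply]
  rfl

end Mean

/-! ### Continuous finite-dimensional representations of compact groups -/

namespace Representation

section Coefficients

variable {G : Type*} [Group G] [TopologicalSpace G]
  {V : Type*} [AddCommGroup V] [Module ℂ V] {W : Type*} [AddCommGroup W] [Module ℂ W]

/-- All matrix coefficients of the representation are continuous. -/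
def HasContinuousCoeffs (ρ : Representation ℂ G V) : Prop :=
  ∀ (v : V) (φ : Dual ℂ V), Continuous fun x : G => φ (ρ x v)

theorem HasContinuousCoeffs.toMatrix {ρ : Representation ℂ G V} (h : ρ.HasContinuousCoeffs)
    {n : Type*} [Fintype n] [DecidableEq n] (b : Basis n ℂ V) :
    Continuous fun x => LinearMap.toMatrix b b (ρ x) := by
  refine continuous_matrix fun i j => ?_
  simp only [LinearMap.toMatrix_apply]
  exact h (b j) (b.coord i)

variable [FiniteDimensional ℂ V]

theorem HasContinuousCoeffs.continuous_comp {ρ : Representation ℂ G V}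
    (h : ρ.HasContinuousCoeffs) (Φ : End ℂ V →ₗ[ℂ] ℂ) : Continuous fun x => Φ (ρ x) := by
  let b := finBasis ℂ V
  have h1 : ∀ x, Φ (ρ x) =
      (Φ ∘ₗ (LinearMap.toMatrix b b).symm.toLinearMap) (LinearMap.toMatrix b b (ρ x)) := by
    intro x
    simp
  simp only [h1]
  exact (LinearMap.continuous_of_finiteDimensional _).comp (h.toMatrix b)

theorem HasContinuousCoeffs.continuous_character {ρ : Representation ℂ G V}
    (h : ρ.HasContinuousCoeffs) : Continuous ρ.character :=
  h.continuous_comp (LinearMap.trace ℂ V)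

theorem HasContinuousCoeffs.linHom [FiniteDimensional ℂ W] [IsTopologicalGroup G]
    {ρ : Representation ℂ G V} {σ : Representation ℂ G W}
    (hρ : ρ.HasContinuousCoeffs) (hσ : σ.HasContinuousCoeffs) :
    (ρ.linHom σ).HasContinuousCoeffs := by
  intro T Φ
  let b := finBasis ℂ V
  let c := finBasis ℂ W
  have h1 : ∀ x, Φ (ρ.linHom σ x T) = (Φ ∘ₗ (LinearMap.toMatrix b c).symm.toLinearMap)
      (LinearMap.toMatrix c c (σ x) * LinearMap.toMatrix b c T *
        LinearMap.toMatrix b b (ρ x⁻¹)) := by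
    intro x
    rw [← LinearMap.toMatrix_comp, ← LinearMap.toMatrix_comp]
    simp [linHom_apply, LinearMap.comp_assoc]
  simp only [h1]
  refine (LinearMap.continuous_of_finiteDimensional _).comp ?_
  exact ((hσ.toMatrix c).matrix_mul continuous_const).matrix_mul
    ((hρ.toMatrix b).comp continuous_inv)

omit [FiniteDimensional ℂ V] in
theorem HasContinuousCoeffs.subrepresentation {ρ : Representation ℂ G V}
    (h : ρ.HasContinuousCoeffs) (A : Subrepresentation ρ) :
    A.toRepresentation.HasContinuousCoeffs := by
  intro v φ
  obtain ⟨ψ, hψ⟩ := LinearMap.exists_extend φ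
  have : ∀ x, φ (A.toRepresentation x v) = ψ (ρ x v) := by
    intro x
    rw [← hψ]
    rfl
  simp only [this]
  exact h v ψ

omit [FiniteDimensional ℂ V] in
theorem HasContinuousCoeffs.comp {H : Type*} [Group H] [TopologicalSpace H]
    {ρ : Representation ℂ G V} (h : ρ.HasContinuousCoeffs) {f : H →* G} (hf : Continuous f) :
    HasContinuousCoeffs (ρ.comp f : Representation ℂ H V) :=
  fun v φ => (h v φ).comp hf

end Coefficients

/-! ### Averaging over the group: orthogonality and complete reducibility -/

section Averaging

variable {G : Type*} [Group G] [TopologicalSpace G] [IsTopologicalGroup G] [CompactSpace G]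
  {V : Type*} [AddCommGroup V] [Module ℂ V] [FiniteDimensional ℂ V]
  {W : Type*} [AddCommGroup W] [Module ℂ W] [FiniteDimensional ℂ W]

/-- Averaging over a compact group projects onto the invariants. -/
theorem exists_isProj_invariants {ρ : Representation ℂ G V} (h : ρ.HasContinuousCoeffs) :
    ∃ P : End ℂ V, LinearMap.IsProj ρ.invariants P ∧
      ∀ Φ : Dual ℂ (End ℂ V), Φ P = haarMean fun x => Φ (ρ x) := by
  obtain ⟨P, hP⟩ := exists_dual_eq_haarMean (fun x => ρ x) fun Φ => h.continuous_comp Φ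
  have hPv : ∀ (v : V) (φ : Dual ℂ V), φ (P v) = haarMean fun x => φ (ρ x v) := fun v φ =>
    hP (φ ∘ₗ LinearMap.applyₗ v)
  refine ⟨P, ⟨fun v => ?_, fun v hv => ?_⟩, hP⟩
  · rw [mem_invariants]
    intro y
    refine eval_apply_injective ℂ (LinearMap.ext fun φ => ?_)
    change φ _ = φ _
    have h1 := hPv v (φ ∘ₗ ρ y)
    simp only [LinearMap.comp_apply] at h1
    rw [h1, hPv, ← haarMean_mul_left (fun x => φ (ρ x v)) y]
    simp
  · rw [mem_invariants] at hv
    refine eval_apply_injective ℂ (LinearMap.ext fun φ => ?_)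
    change φ _ = φ _
    rw [hPv]
    simp only [hv, haarMean_const]

/-- The averaged operator is a projection, and the trace of a projection is its rank. -/
theorem haarMean_character {ρ : Representation ℂ G V} (h : ρ.HasContinuousCoeffs) :
    haarMean ρ.character = finrank ℂ ρ.invariants := by
  obtain ⟨P, hP, hP'⟩ := exists_isProj_invariants h
  rw [← hP.trace]
  exact (hP' (LinearMap.trace ℂ V)).symm

/-- The integrand is the character of `Hom(V, W)`, whose invariants are the intertwining maps. With
Schur's lemma this becomes orthogonality of irreducible characters. -/
theorem haarMean_character_mul_character_inv {ρ : Representation ℂ G V} {σ : Representation ℂ G W}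
    (hρ : ρ.HasContinuousCoeffs) (hσ : σ.HasContinuousCoeffs) :
    haarMean (fun x => ρ.character x⁻¹ * σ.character x) = finrank ℂ (IntertwiningMap ρ σ) := by
  rw [← (invariantsEquivIntertwiningMap ρ σ).finrank_eq, ← haarMean_character (hρ.linHom hσ)]
  congr 1
  funext x
  rw [char_linHom]

/-- Complete reducibility. -/
theorem exists_isCompl_subrepresentation {ρ : Representation ℂ G V} (h : ρ.HasContinuousCoeffs)
    (A : Subrepresentation ρ) :
    ∃ B : Subrepresentation ρ, IsCompl A.toSubmodule B.toSubmodule := by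
  obtain ⟨C, hC⟩ := A.toSubmodule.exists_isCompl
  -- A merely linear projection onto `A`. The average of its conjugates is an equivariant projection
  -- onto `A`, and the kernel of that average is the complement sought.
  let π : End ℂ V := A.toSubmodule.projectionOnto C hC |> A.toSubmodule.subtype.comp
  obtain ⟨P, hP, hP'⟩ := exists_isProj_invariants (h.linHom h)
  have key : ∀ (v : V) (φ : Dual ℂ V),
      φ (P π v) = haarMean fun x => φ (ρ x (π (ρ x⁻¹ v))) := fun v φ =>
    hP' (φ ∘ₗ LinearMap.applyₗ v ∘ₗ LinearMap.applyₗ π)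
  have hproj : LinearMap.IsProj A.toSubmodule (P π) := by
    refine ⟨fun v => ?_, fun v hv => ?_⟩
    · by_contra hv
      obtain ⟨φ, hφ, hφA⟩ := Submodule.exists_dual_map_eq_bot_of_notMem hv inferInstance
      apply hφ
      rw [key]
      have : ∀ x, φ (ρ x (π (ρ x⁻¹ v))) = 0 := by
        intro x
        have hm : φ (ρ x (π (ρ x⁻¹ v))) ∈ Submodule.map φ A.toSubmodule :=
          Submodule.mem_map_of_mem (A.apply_mem_toSubmodule x (Subtype.property _))
        rw [hφA] at hm
        simpa using hm
      simp only [this, haarMean_const]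
    · refine eval_apply_injective ℂ (LinearMap.ext fun φ => ?_)
      change φ _ = φ _
      rw [key]
      have : ∀ x, ρ x (π (ρ x⁻¹ v)) = v := by
        intro x
        have h1 : π (ρ x⁻¹ v) = ρ x⁻¹ v := by
          have := Submodule.projectionOnto_apply_left hC
            ⟨ρ x⁻¹ v, A.apply_mem_toSubmodule _ hv⟩
          exact congrArg Subtype.val this
        rw [h1]
        simp
      simp only [this, haarMean_const]
  have hcomm : ∀ y v, P π (ρ y v) = ρ y (P π v) := by
    intro y v
    have h1 := (mem_invariants _ _).mp (hP.map_mem π) y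
    have h2 := congrArg (fun T : End ℂ V => T (ρ y v)) h1
    simp [linHom_apply] at h2
    exact h2.symm
  refine ⟨⟨LinearMap.ker (P π), fun y v hv => ?_⟩, hproj.isCompl⟩
  rw [LinearMap.mem_ker] at hv ⊢
  rw [hcomm, hv, map_zero]

omit [TopologicalSpace G] [IsTopologicalGroup G] [CompactSpace G] in
theorem character_eq_add_of_isCompl {ρ : Representation ℂ G V} {A B : Subrepresentation ρ}
    (h : IsCompl A.toSubmodule B.toSubmodule) :
    ρ.character = A.toRepresentation.character + B.toRepresentation.character := by
  funext x
  have h1 := LinearMap.trace_eq_sum_trace_restrict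
    (N := fun b : Bool => if b then A.toSubmodule else B.toSubmodule)
    ((DirectSum.isInternal_submodule_iff_isCompl _ (i := true) (j := false) (by simp)
      (by ext b; cases b <;> simp)).mpr (by simpa using h)) (f := ρ x)
    (by
      intro b
      cases b
      · exact fun v hv => B.apply_mem_toSubmodule x hv
      · exact fun v hv => A.apply_mem_toSubmodule x hv)
  rw [Fintype.sum_bool] at h1
  exact h1

end Averaging

end Representation

end

/-! ### Continuous representations of the torus and their weights -/

noncomputable section

open Module

/-! ### Fourier analysis on the torus -/

section Torus

variable {g : ℕ}

/-- The character `z ↦ ∏ k, z k ^ μ k` of the torus. -/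
def torusMonomial (μ : Fin g → ℤ) : (Fin g → Circle) →* ℂ where
  toFun z := ∏ k, (z k : ℂ) ^ μ k
  map_one' := by simp
  map_mul' z w := by simp [mul_zpow, Finset.prod_mul_distrib]

theorem torusMonomial_apply (μ : Fin g → ℤ) (z : Fin g → Circle) :
    torusMonomial μ z = ∏ k, (z k : ℂ) ^ μ k := rfl

theorem torusMonomial_zero (z : Fin g → Circle) : torusMonomial 0 z = 1 := by
  simp [torusMonomial_apply]

theorem torusMonomial_add (μ ν : Fin g → ℤ) (z : Fin g → Circle) :
    torusMonomial (μ + ν) z = torusMonomial μ z * torusMonomial ν z := by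
  simp [torusMonomial_apply, zpow_add₀, Finset.prod_mul_distrib]

theorem torusMonomial_neg_mul (μ : Fin g → ℤ) (z : Fin g → Circle) :
    torusMonomial (-μ) z * torusMonomial μ z = 1 := by
  rw [← torusMonomial_add, neg_add_cancel, torusMonomial_zero]

theorem star_torusMonomial (μ : Fin g → ℤ) (z : Fin g → Circle) :
    star (torusMonomial μ z) = torusMonomial (-μ) z := by
  simp only [torusMonomial_apply, star_prod, star_zpow₀, Pi.neg_apply, zpow_neg]
  refine Finset.prod_congr rfl fun k _ => ?_
  rw [Complex.star_def, ← Circle.coe_inv_eq_conj, Circle.coe_inv, inv_zpow]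

theorem continuous_torusMonomial (μ : Fin g → ℤ) :
    Continuous (torusMonomial μ : (Fin g → Circle) → ℂ) := by
  change Continuous fun z : Fin g → Circle => ∏ k, (z k : ℂ) ^ μ k
  refine continuous_finsetProd _ fun k _ => ?_
  exact (continuous_subtype_val.comp (continuous_apply k)).zpow₀ _ fun z =>
    Or.inl (Circle.coe_ne_zero _)

theorem haarMean_torusMonomial_of_ne_zero {μ : Fin g → ℤ} (h : μ ≠ 0) :
    haarMean (torusMonomial μ) = 0 := by
  obtain ⟨k, hk⟩ := Function.ne_iff.mp h
  rw [Pi.zero_apply] at hk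
  -- The monomial takes the value `-1` at `w`, so translation by `w` forces its mean to equal its
  -- own negative.
  let w : Fin g → Circle := Function.update 1 k (Circle.exp (Real.pi / μ k))
  have hw : torusMonomial μ w = -1 := by
    rw [torusMonomial_apply, Finset.prod_eq_single k]
    · have : (Circle.exp (Real.pi / μ k)) ^ μ k = Circle.exp Real.pi := by
        ext1
        rw [Circle.coe_zpow, Circle.coe_exp, Circle.coe_exp, ← Complex.exp_int_mul]
        congr 1
        have : (μ k : ℂ) ≠ 0 := by exact_mod_cast hk
        push_cast
        field_simp
      simp only [w, Function.update_self]
      rw [← Circle.coe_zpow, this]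
      simp
    · intro j _ hj
      simp [w, hj]
    · simp
  have h1 := haarMean_mul_left (torusMonomial μ) w
  simp only [map_mul, hw, haarMean_const_mul] at h1
  linear_combination (-1 / 2) * h1

theorem haarMean_torusMonomial (μ : Fin g → ℤ) :
    haarMean (torusMonomial μ) = if μ = 0 then 1 else 0 := by
  split_ifs with h
  · subst h
    simp only [funext (torusMonomial_zero (g := g)), haarMean_const]
  · exact haarMean_torusMonomial_of_ne_zero h

/-- The trigonometric polynomial with the given coefficients. -/
def trigPoly (m : (Fin g → ℤ) →₀ ℂ) (z : Fin g → Circle) : ℂ :=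
  m.sum fun μ c => c * torusMonomial μ z

theorem trigPoly_sub (m n : (Fin g → ℤ) →₀ ℂ) (z : Fin g → Circle) :
    trigPoly (m - n) z = trigPoly m z - trigPoly n z :=
  Finsupp.sum_sub_index fun _ _ _ => sub_mul _ _ _

theorem trigPoly_smul (c : ℂ) (m : (Fin g → ℤ) →₀ ℂ) (z : Fin g → Circle) :
    trigPoly (c • m) z = c * trigPoly m z := by
  rw [trigPoly, Finsupp.sum_smul_index' (fun _ => zero_mul _), trigPoly, Finsupp.mul_sum]
  simp [mul_assoc]

theorem continuous_trigPoly (m : (Fin g → ℤ) →₀ ℂ) : Continuous (trigPoly m) :=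
  continuous_finsetSum _ fun μ _ => continuous_const.mul (continuous_torusMonomial μ)

theorem haarMean_trigPoly (m : (Fin g → ℤ) →₀ ℂ) (μ : Fin g → ℤ) :
    haarMean (fun z => torusMonomial (-μ) z * trigPoly m z) = m μ := by
  have h1 : (fun z => torusMonomial (-μ) z * trigPoly m z) =
      fun z => ∑ ν ∈ m.support, m ν * torusMonomial (ν - μ) z := by
    funext z
    rw [trigPoly, Finsupp.sum, Finset.mul_sum]
    refine Finset.sum_congr rfl fun ν _ => ?_
    rw [sub_eq_add_neg, torusMonomial_add]
    ring
  rw [h1, haarMean_sum _ (f := fun ν z => m ν * torusMonomial (ν - μ) z)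
    fun ν _ => continuous_const.mul (continuous_torusMonomial _)]
  simp only [haarMean_const_mul, haarMean_torusMonomial, sub_eq_zero]
  simp +contextual

theorem trigPoly_injective : Function.Injective (trigPoly (g := g)) := by
  intro m n h
  ext μ
  rw [← haarMean_trigPoly m, h, haarMean_trigPoly]

/-- The algebra of trigonometric polynomials on the torus. -/
def trigSubalgebra (g : ℕ) : StarSubalgebra ℂ C(Fin g → Circle, ℂ) where
  toSubalgebra := Algebra.adjoin ℂ
    (Set.range fun μ : Fin g → ℤ => (⟨torusMonomial μ, continuous_torusMonomial μ⟩ :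
      C(Fin g → Circle, ℂ)))
  star_mem' := by
    change _ ≤ star (Algebra.adjoin ℂ _)
    refine Algebra.adjoin_le ?_
    rintro - ⟨μ, rfl⟩
    refine Algebra.subset_adjoin ⟨-μ, ?_⟩
    ext1 z
    exact (star_torusMonomial μ z).symm

theorem trigSubalgebra_separatesPoints (g : ℕ) :
    (trigSubalgebra g).SeparatesPoints := by
  intro z w h
  obtain ⟨k, hk⟩ := Function.ne_iff.mp h
  have h1 : ∀ z : Fin g → Circle, torusMonomial (Pi.single k 1) z = z k := by
    intro z
    rw [torusMonomial_apply, Finset.prod_eq_single k]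
    · simp
    · intro j _ hj
      simp [hj]
    · simp
  refine ⟨_, ⟨_, Algebra.subset_adjoin ⟨Pi.single k 1, rfl⟩, rfl⟩, ?_⟩
  simp only [ContinuousMap.coe_mk, h1]
  exact fun h2 => hk (Circle.ext h2)

theorem mem_trigSubalgebra_iff {a : C(Fin g → Circle, ℂ)} (ha : a ∈ trigSubalgebra g) :
    a ∈ Submodule.span ℂ (Set.range fun μ : Fin g → ℤ =>
      (⟨torusMonomial μ, continuous_torusMonomial μ⟩ : C(Fin g → Circle, ℂ))) := by
  have h1 : a ∈ Subalgebra.toSubmodule (Algebra.adjoin ℂ _) := ha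
  rw [Algebra.adjoin_eq_span] at h1
  refine Submodule.span_mono ?_ h1
  intro b hb
  induction hb using Submonoid.closure_induction with
  | mem x hx => exact hx
  | one => exact ⟨0, by ext1 z; exact torusMonomial_zero z⟩
  | mul x y _ _ hx hy =>
    obtain ⟨μ, rfl⟩ := hx
    obtain ⟨ν, rfl⟩ := hy
    exact ⟨μ + ν, by ext1 z; exact torusMonomial_add μ ν z⟩

/-- A continuous function on the torus is determined by its Fourier coefficients. -/
theorem eq_zero_of_haarMean_torusMonomial_mul {f : (Fin g → Circle) → ℂ} (hf : Continuous f)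
    (h : ∀ μ : Fin g → ℤ, haarMean (fun z => torusMonomial μ z * f z) = 0) : f = 0 := by
  let F : C(Fin g → Circle, ℂ) := ⟨f, hf⟩
  have hlin : ∀ a ∈ trigSubalgebra g, haarMean (fun z => a z * f z) = 0 := by
    intro a ha
    replace ha := mem_trigSubalgebra_iff ha
    induction ha using Submodule.span_induction with
    | mem x hx =>
      obtain ⟨μ, rfl⟩ := hx
      exact h μ
    | zero => simp [haarMean_const]
    | add x y _ _ hx hy =>
      simp only [ContinuousMap.add_apply, add_mul]
      rw [haarMean_add (f := fun z => x z * f z) (h := fun z => y z * f z)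
        (x.continuous.mul hf) (y.continuous.mul hf), hx, hy, add_zero]
    | smul c x _ hx =>
      simp only [ContinuousMap.smul_apply, smul_eq_mul, mul_assoc, haarMean_const_mul, hx, mul_zero]
  -- By Stone–Weierstrass the conjugate of `f` is a uniform limit of trigonometric polynomials `a`,
  -- and each `a * f` has mean zero; hence so has `f * star f`.
  refine eq_zero_of_haarMean_mul_star hf ?_
  rw [← norm_eq_zero]
  refine le_antisymm (le_of_forall_pos_le_add fun ε hε => ?_) (norm_nonneg _)
  have hdense : star F ∈ (trigSubalgebra g).topologicalClosure := by
    rw [ContinuousMap.starSubalgebra_topologicalClosure_eq_top_of_separatesPoints _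
      (trigSubalgebra_separatesPoints g)]
    trivial
  -- The summand `1` keeps the denominator positive when `F = 0`.
  have hpos : 0 < ε / (‖F‖ + 1) := by positivity
  obtain ⟨a, ha, hda⟩ := Metric.mem_closure_iff.mp hdense _ hpos
  have h2 : haarMean (fun z => f z * star (f z)) =
      haarMean (fun z => (star F z - a z) * f z) := by
    have h3 : (fun z => f z * star (f z)) = fun z => (star F z - a z) * f z + a z * f z := by
      funext z
      simp [F]
      ring
    rw [h3, haarMean_add (f := fun z => (star F z - a z) * f z) (h := fun z => a z * f z)
      (((star F).continuous.sub a.continuous).mul hf) (a.continuous.mul hf), hlin a ha, add_zero]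
  rw [h2, zero_add]
  refine norm_haarMean_le fun z => ?_
  rw [norm_mul]
  have h4 : ‖star F z - a z‖ ≤ ε / (‖F‖ + 1) := by
    have := ContinuousMap.norm_coe_le_norm (star F - a) z
    rw [dist_eq_norm] at hda
    exact this.trans hda.le
  have h5 : ‖f z‖ ≤ ‖F‖ := ContinuousMap.norm_coe_le_norm F z
  calc ‖star F z - a z‖ * ‖f z‖ ≤ ε / (‖F‖ + 1) * (‖F‖ + 1) := by
        gcongr
        linarith
    _ = ε := by field_simp

end Torus

/-! ### Weights of continuous representations of the torus -/

section Weights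

variable {g : ℕ} {V : Type*} [AddCommGroup V] [Module ℂ V]

/-- The weight space of weight `μ` of a representation of the torus. -/
def torusWeightSpace (ρ : Representation ℂ (Fin g → Circle) V) (μ : Fin g → ℤ) :
    Submodule ℂ V where
  carrier := {v | ∀ z, ρ z v = torusMonomial μ z • v}
  add_mem' hv hw z := by rw [map_add, hv z, hw z, smul_add]
  zero_mem' z := by simp
  smul_mem' c v hv z := by rw [map_smul, hv z, smul_comm]

theorem mem_torusWeightSpace {ρ : Representation ℂ (Fin g → Circle) V} {μ : Fin g → ℤ} {v : V} :
    v ∈ torusWeightSpace ρ μ ↔ ∀ z, ρ z v = torusMonomial μ z • v := Iff.rfl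

variable [FiniteDimensional ℂ V]

/-- Twisting the representation by the inverse character turns the weight space into the space of
invariants. -/
theorem haarMean_torusMonomial_mul_character {ρ : Representation ℂ (Fin g → Circle) V}
    (h : ρ.HasContinuousCoeffs) (μ : Fin g → ℤ) :
    haarMean (fun z => torusMonomial (-μ) z * ρ.character z) =
      finrank ℂ (torusWeightSpace ρ μ) := by
  let σ : Representation ℂ (Fin g → Circle) V :=
    { toFun := fun z => torusMonomial (-μ) z • ρ z
      map_one' := by simp
      map_mul' := fun z w => by
        simp only [map_mul]
        rw [smul_mul_smul_comm] }
  have hσ : σ.HasContinuousCoeffs := by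
    intro v φ
    have : ∀ z, φ (σ z v) = torusMonomial (-μ) z * φ (ρ z v) := by
      intro z
      change φ (torusMonomial (-μ) z • ρ z v) = _
      rw [map_smul, smul_eq_mul]
    simp only [this]
    exact (continuous_torusMonomial _).mul (h v φ)
  have h1 : σ.invariants = torusWeightSpace ρ μ := by
    ext v
    rw [Representation.mem_invariants, mem_torusWeightSpace]
    refine forall_congr' fun z => ?_
    change torusMonomial (-μ) z • ρ z v = v ↔ _
    have h2 := torusMonomial_neg_mul μ z
    constructor
    · intro h3
      conv_rhs => rw [← h3]
      rw [smul_smul, mul_comm, h2, one_smul]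
    · intro h3
      rw [h3, smul_smul, h2, one_smul]
  rw [← h1, ← Representation.haarMean_character hσ]
  congr 1
  funext z
  change _ = LinearMap.trace ℂ V (torusMonomial (-μ) z • ρ z)
  rw [map_smul]
  rfl

/-- Nonzero vectors of distinct weights are independent: translating a relation by the torus and
applying a functional yields a vanishing trigonometric polynomial, whose coefficients must all
vanish. -/
theorem finite_torusWeights (ρ : Representation ℂ (Fin g → Circle) V) :
    {μ | torusWeightSpace ρ μ ≠ ⊥}.Finite := by
  choose v hv hv0 using fun μ : {μ | torusWeightSpace ρ μ ≠ ⊥} =>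
    (Submodule.ne_bot_iff _).mp μ.2
  have hli : LinearIndependent ℂ v := by
    rw [linearIndependent_iff]
    intro c hc
    ext μ
    by_contra hne
    obtain ⟨φ, hφ⟩ := not_forall.mp (mt (forall_dual_apply_eq_zero_iff ℂ (v μ)).mp (hv0 μ))
    let m : (Fin g → ℤ) →₀ ℂ :=
      c.sum fun ν a => Finsupp.single ν.1 (a * φ (v ν))
    have hm : m μ.1 = c μ * φ (v μ) := by
      simp only [m, Finsupp.sum, Finsupp.finsetSum_apply, Finsupp.single_apply]
      rw [Finset.sum_eq_single μ]
      · simp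
      · intro b _ hb
        rw [if_neg fun h => hb (Subtype.ext h)]
      · intro h
        exact absurd (Finsupp.notMem_support_iff.mp h) hne
    have hz : trigPoly m = trigPoly 0 := by
      funext z
      have h1 := congrArg (fun u => φ (ρ z u)) hc
      simp only [Finsupp.linearCombination_apply, Finsupp.sum, map_sum, map_smul,
        (mem_torusWeightSpace.mp (hv _)) z, map_zero, smul_eq_mul] at h1
      rw [trigPoly, trigPoly, Finsupp.sum_zero_index, ← h1,
        Finsupp.sum_sum_index (fun _ => zero_mul _) (fun _ _ _ => add_mul _ _ _)]
      simp only [Finsupp.sum]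
      refine Finset.sum_congr rfl fun ν _ => ?_
      exact (Finsupp.sum_single_index (h := fun ν a => a * torusMonomial ν z)
        (zero_mul _)).trans (by ring)
    have := trigPoly_injective hz
    rw [this] at hm
    exact mul_ne_zero hne hφ hm.symm
  exact Set.finite_coe_iff.mp hli.finite

/-- The formal character of a representation of the torus. -/
def formalCharacter (ρ : Representation ℂ (Fin g → Circle) V) : (Fin g → ℤ) →₀ ℂ :=
  Finsupp.onFinset (finite_torusWeights ρ).toFinset
    (fun μ => (finrank ℂ (torusWeightSpace ρ μ) : ℂ)) fun μ h => by
      rw [Set.Finite.mem_toFinset]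
      intro hbot
      exact h (by simp [hbot])

theorem formalCharacter_apply (ρ : Representation ℂ (Fin g → Circle) V) (μ : Fin g → ℤ) :
    formalCharacter ρ μ = finrank ℂ (torusWeightSpace ρ μ) := rfl

/-- Both sides are continuous with the same Fourier coefficients, so no simultaneous diagonalisation
is required. -/
theorem character_eq_trigPoly {ρ : Representation ℂ (Fin g → Circle) V}
    (h : ρ.HasContinuousCoeffs) : ρ.character = trigPoly (formalCharacter ρ) := by
  rw [← sub_eq_zero]
  refine eq_zero_of_haarMean_torusMonomial_mul
    (h.continuous_character.sub (continuous_trigPoly _)) fun μ => ?_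
  have h1 : (fun z => torusMonomial μ z * (ρ.character - trigPoly (formalCharacter ρ)) z) =
      fun z => torusMonomial (-(-μ)) z * ρ.character z +
        (-1) * (torusMonomial (-(-μ)) z * trigPoly (formalCharacter ρ) z) := by
    funext z
    rw [neg_neg, Pi.sub_apply]
    ring
  rw [h1, haarMean_add, haarMean_const_mul, haarMean_torusMonomial_mul_character h,
    haarMean_trigPoly, formalCharacter_apply]
  · ring
  · exact (continuous_torusMonomial _).mul h.continuous_character
  · exact continuous_const.mul ((continuous_torusMonomial _).mul (continuous_trigPoly _))

end Weights

end

/-! ### The group `USp(2g)`: compactness, Weyl elements, conjugation into the torus -/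

noncomputable section

open Module Matrix

namespace USp

variable {g : ℕ}

/-! ### The compact topological group `USp(2g)` -/

theorem toMatrix_mul (x y : USp g) : toMatrix (x * y) = toMatrix x * toMatrix y := rfl

theorem toMatrix_injective : Function.Injective (toMatrix (g := g)) := fun _ _ h =>
  Subtype.ext (Subtype.ext h)

theorem toMatrix_mul_conjTranspose (x : USp g) : toMatrix x * (toMatrix x)ᴴ = 1 :=
  mem_unitaryGroup_iff.mp x.1.2

theorem conjTranspose_mul_toMatrix (x : USp g) : (toMatrix x)ᴴ * toMatrix x = 1 :=
  mem_unitaryGroup_iff'.mp x.1.2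

theorem toMatrix_mul_J_mul_transpose (x : USp g) :
    toMatrix x * J (Fin g) ℂ * (toMatrix x)ᵀ = J (Fin g) ℂ :=
  SymplecticGroup.mem_iff.mp x.2

/-- The element of `USp(2g)` with the given matrix. -/
def ofMatrix (A : Matrix (Fin g ⊕ Fin g) (Fin g ⊕ Fin g) ℂ) (h : A * Aᴴ = 1)
    (h' : A * J (Fin g) ℂ * Aᵀ = J (Fin g) ℂ) : USp g :=
  ⟨⟨A, mem_unitaryGroup_iff.mpr h⟩, SymplecticGroup.mem_iff.mpr h'⟩

theorem toMatrix_ofMatrix (A : Matrix (Fin g ⊕ Fin g) (Fin g ⊕ Fin g) ℂ) (h : A * Aᴴ = 1)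
    (h' : A * J (Fin g) ℂ * Aᵀ = J (Fin g) ℂ) : toMatrix (ofMatrix A h h') = A := rfl

theorem isInducing_toMatrix : Topology.IsInducing (toMatrix (g := g)) :=
  Topology.IsInducing.subtypeVal.comp Topology.IsInducing.subtypeVal

theorem continuous_toMatrix : Continuous (toMatrix (g := g)) := isInducing_toMatrix.continuous

instance : CompactSpace (USp g) := by
  refine ⟨isInducing_toMatrix.isCompact_iff.mpr ?_⟩
  have hr : toMatrix '' (Set.univ : Set (USp g)) =
      {A | A * Aᴴ = 1} ∩ {A | A * J (Fin g) ℂ * Aᵀ = J (Fin g) ℂ} := by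
    ext A
    constructor
    · rintro ⟨x, -, rfl⟩
      exact ⟨toMatrix_mul_conjTranspose x, toMatrix_mul_J_mul_transpose x⟩
    · rintro ⟨h, h'⟩
      exact ⟨ofMatrix A h h', trivial, rfl⟩
  rw [hr]
  have hK : IsCompact (Set.univ.pi fun _ : Fin g ⊕ Fin g => Set.univ.pi
      fun _ : Fin g ⊕ Fin g => Metric.closedBall (0 : ℂ) 1) :=
    isCompact_univ_pi fun _ => isCompact_univ_pi fun _ => isCompact_closedBall _ _
  refine hK.of_isClosed_subset ?_ ?_
  · refine IsClosed.inter (isClosed_eq ?_ continuous_const) (isClosed_eq ?_ continuous_const)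
    · exact continuous_id.matrix_mul continuous_id.matrix_conjTranspose
    · exact (continuous_id.matrix_mul continuous_const).matrix_mul continuous_id.matrix_transpose
  · rintro A ⟨h, -⟩ i - j -
    rw [mem_closedBall_zero_iff]
    exact entry_norm_bound_of_unitary (mem_unitaryGroup_iff.mpr h) i j

/-- The standard maximal torus. -/
def torusHom (g : ℕ) : (Fin g → Circle) →* USp g where
  toFun := torus
  map_one' := by
    refine toMatrix_injective ?_
    change diagonal _ = (1 : Matrix _ _ ℂ)
    rw [← diagonal_one]
    congr 1
    funext k
    rcases k with k | k <;> simp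
  map_mul' z w := by
    refine toMatrix_injective ?_
    change diagonal _ = diagonal _ * diagonal _
    rw [diagonal_mul_diagonal]
    congr 1
    funext k
    rcases k with k | k <;> simp [mul_comm]

theorem toMatrix_torus (z : Fin g → Circle) :
    toMatrix (torus z) =
      diagonal (Sum.elim (fun k => (z k : ℂ)) fun k => ((z k)⁻¹ : Circle)) := rfl

theorem continuous_torusHom : Continuous (torusHom g) := by
  refine isInducing_toMatrix.continuous_iff.mpr ?_
  refine Continuous.matrix_diagonal (continuous_pi fun k => ?_)
  rcases k with k | k
  · exact continuous_subtype_val.comp (continuous_apply k)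
  · exact continuous_subtype_val.comp (continuous_apply k).inv

/-! ### Some elements -/

/-- The embedding of `U(g)` in `USp(2g)`. -/
def ofUnitary (A : unitaryGroup (Fin g) ℂ) : USp g :=
  ofMatrix (fromBlocks A.1 0 0 (A.1.map (starRingEnd ℂ)))
    (by
      have h : A.1 * A.1ᴴ = 1 := mem_unitaryGroup_iff.mp A.2
      have h2 : A.1.map (starRingEnd ℂ) * (A.1.map (starRingEnd ℂ))ᴴ = 1 := by
        have := congrArg (fun B => B.map (starRingEnd ℂ)) h
        rw [Matrix.map_mul, Matrix.map_one _ (map_zero _) (map_one _)] at this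
        exact this
      rw [fromBlocks_conjTranspose, fromBlocks_multiply]
      simp [h, h2])
    (by
      have h : A.1 * A.1ᴴ = 1 := mem_unitaryGroup_iff.mp A.2
      have h1 : A.1 * (A.1.map (starRingEnd ℂ))ᵀ = 1 := h
      have h2 : A.1.map (starRingEnd ℂ) * A.1ᵀ = 1 := by
        have := congrArg transpose h
        rwa [transpose_mul, transpose_one] at this
      simp [J, fromBlocks_transpose, fromBlocks_multiply, h1, h2])

/-- The element of `USp(2g)` that exchanges `e_k` and `e_{-k}` up to sign for `k ∈ P`. -/
def signFlip (P : Finset (Fin g)) : USp g :=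
  ofMatrix (fromBlocks (diagonal fun k => if k ∈ P then 0 else 1)
      (diagonal fun k => if k ∈ P then -1 else 0) (diagonal fun k => if k ∈ P then 1 else 0)
      (diagonal fun k => if k ∈ P then 0 else 1))
    (by
      rw [fromBlocks_conjTranspose, fromBlocks_multiply, ← fromBlocks_one]
      simp only [diagonal_conjTranspose, diagonal_mul_diagonal, diagonal_add, ← diagonal_one,
        ← diagonal_zero]
      congr <;> funext k <;> by_cases h : k ∈ P <;> simp [h])
    (by
      simp only [J, fromBlocks_transpose, fromBlocks_multiply, diagonal_transpose, mul_zero,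
        zero_add, add_zero, mul_one, mul_neg, neg_mul, diagonal_mul_diagonal, diagonal_neg,
        diagonal_add, ← diagonal_one, ← diagonal_zero]
      congr <;> funext k <;> by_cases h : k ∈ P <;> simp [h])

/-- The element of `USp(2g)` that permutes the coordinates. -/
def ofPerm (σ : Equiv.Perm (Fin g)) : USp g :=
  ofUnitary ⟨(σ⁻¹).permMatrix ℂ, by
    rw [mem_unitaryGroup_iff, star_eq_conjTranspose, conjTranspose_permMatrix,
      ← permMatrix_mul]
    simp⟩

/-- The rotation with cosine `3/5` and sine `4/5` in the plane of two coordinates. -/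
def planeRotation (p q : Fin g) : Matrix (Fin g) (Fin g) ℂ :=
  -- Here `1 - 2/5 = 3/5`. Any angle whose sine and cosine are both nonzero would serve; the `3-4-5`
  -- triangle keeps the entries rational.
  1 - (2 / 5 : ℂ) • (single p p 1 + single q q 1) + (4 / 5 : ℂ) • (single q p 1 - single p q 1)

theorem planeRotation_mem_unitaryGroup {p q : Fin g} (h : p ≠ q) :
    planeRotation p q ∈ unitaryGroup (Fin g) ℂ := by
  rw [mem_unitaryGroup_iff, star_eq_conjTranspose]
  have h1 : (planeRotation p q)ᴴ = 1 - (2 / 5 : ℂ) • (single p p 1 + single q q 1) -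
      (4 / 5 : ℂ) • (single q p 1 - single p q 1) := by
    have h2 : star (2 / 5 : ℂ) = 2 / 5 := by simp
    have h4 : star (4 / 5 : ℂ) = 4 / 5 := by simp
    simp only [planeRotation, conjTranspose_add, conjTranspose_sub, conjTranspose_smul,
      conjTranspose_one, conjTranspose_single, star_one, h2, h4]
    module
  rw [h1, planeRotation]
  simp only [add_mul, sub_mul, mul_add, mul_sub, smul_mul_assoc, mul_smul_comm, one_mul, mul_one,
    single_mul_single_same, single_mul_single_of_ne _ _ _ _ h,
    single_mul_single_of_ne _ _ _ _ h.symm]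
  module

/-- The rotation of `USp(2g)` in the planes of `e_p, e_q` and of `e_{-p}, e_{-q}`. -/
def rotation {p q : Fin g} (h : p ≠ q) : USp g :=
  ofUnitary ⟨planeRotation p q, planeRotation_mem_unitaryGroup h⟩

theorem toMatrix_ofPerm (σ : Equiv.Perm (Fin g)) :
    toMatrix (ofPerm σ) = fromBlocks ((σ⁻¹).permMatrix ℂ) 0 0
      (((σ⁻¹).permMatrix ℂ).map (starRingEnd ℂ)) := rfl

theorem toMatrix_signFlip (P : Finset (Fin g)) :
    toMatrix (signFlip P) = fromBlocks (diagonal fun k => if k ∈ P then 0 else 1)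
      (diagonal fun k => if k ∈ P then -1 else 0) (diagonal fun k => if k ∈ P then 1 else 0)
      (diagonal fun k => if k ∈ P then 0 else 1) := rfl

theorem toMatrix_rotation {p q : Fin g} (h : p ≠ q) :
    toMatrix (rotation h) = fromBlocks (planeRotation p q) 0 0
      ((planeRotation p q).map (starRingEnd ℂ)) := rfl

theorem standardRep_single (x : USp g) (s : Fin g ⊕ Fin g) :
    standardRep g x (Pi.single s 1) = (toMatrix x).col s := by
  change toMatrix x *ᵥ _ = _
  exact mulVec_single_one _ _

theorem standardRep_ofPerm (σ : Equiv.Perm (Fin g)) (p : Fin g) :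
    standardRep g (ofPerm σ) (Pi.single (Sum.inl p) 1) = Pi.single (Sum.inl (σ p)) 1 := by
  rw [standardRep_single, toMatrix_ofPerm]
  funext t
  rcases t with t | t
  · simp [Pi.single_apply, PEquiv.toMatrix_apply, Equiv.toPEquiv_apply, Equiv.symm_apply_eq]
  · simp

theorem standardRep_signFlip (P : Finset (Fin g)) (p : Fin g) :
    standardRep g (signFlip P) (Pi.single (Sum.inl p) 1) =
      Pi.single (if p ∈ P then Sum.inr p else Sum.inl p) 1 := by
  rw [standardRep_single, toMatrix_signFlip]
  funext t
  rcases t with t | t <;> by_cases h : p ∈ P <;>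
    simp +contextual [h, Pi.single_apply, diagonal_apply]

theorem planeRotation_apply_of_ne {p q r : Fin g} (hp : r ≠ p) (hq : r ≠ q) (t : Fin g) :
    planeRotation p q t r = (1 : Matrix (Fin g) (Fin g) ℂ) t r := by
  simp [planeRotation, hp.symm, hq.symm]

theorem planeRotation_apply_left {p q : Fin g} (h : p ≠ q) (t : Fin g) :
    planeRotation p q t p = 3 / 5 * (1 : Matrix (Fin g) (Fin g) ℂ) t p +
      4 / 5 * (1 : Matrix (Fin g) (Fin g) ℂ) t q := by
  simp only [planeRotation, Matrix.add_apply, Matrix.sub_apply, Matrix.smul_apply, single_apply, one_apply, smul_eq_mul,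
    h.symm, and_false, and_true, if_false, eq_comm (a := t)]
  split_ifs <;> norm_num

theorem planeRotation_apply_right {p q : Fin g} (h : p ≠ q) (t : Fin g) :
    planeRotation p q t q = -(4 / 5) * (1 : Matrix (Fin g) (Fin g) ℂ) t p +
      3 / 5 * (1 : Matrix (Fin g) (Fin g) ℂ) t q := by
  simp only [planeRotation, Matrix.add_apply, Matrix.sub_apply, Matrix.smul_apply, single_apply, one_apply, smul_eq_mul,
    h, and_false, and_true, if_false, eq_comm (a := t)]
  split_ifs <;> norm_num

theorem standardRep_rotation_inl_left {p q : Fin g} (h : p ≠ q) :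
    standardRep g (rotation h) (Pi.single (Sum.inl p) 1) =
      (3 / 5 : ℂ) • Pi.single (Sum.inl p) 1 + (4 / 5 : ℂ) • Pi.single (Sum.inl q) 1 := by
  rw [standardRep_single, toMatrix_rotation]
  funext t
  rcases t with t | t <;>
    simp [Pi.single_apply, planeRotation_apply_left h, one_apply]

theorem standardRep_rotation_inr_right {p q : Fin g} (h : p ≠ q) :
    standardRep g (rotation h) (Pi.single (Sum.inr q) 1) =
      (-(4 / 5) : ℂ) • Pi.single (Sum.inr p) 1 + (3 / 5 : ℂ) • Pi.single (Sum.inr q) 1 := by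
  rw [standardRep_single, toMatrix_rotation]
  funext t
  rcases t with t | t
  · simp
  · simp [Pi.single_apply, planeRotation_apply_right h, one_apply, apply_ite (starRingEnd ℂ),
      map_ofNat]
    split_ifs <;> simp

theorem standardRep_rotation_of_ne {p q : Fin g} (h : p ≠ q) {s : Fin g ⊕ Fin g}
    (hp : Sum.elim id id s ≠ p) (hq : Sum.elim id id s ≠ q) :
    standardRep g (rotation h) (Pi.single s 1) = Pi.single s 1 := by
  rw [standardRep_single, toMatrix_rotation]
  funext t
  rcases s with s | s <;> rcases t with t | t <;> simp only [Sum.elim_inl, Sum.elim_inr, id] at hp hq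
  all_goals simp [Pi.single_apply, planeRotation_apply_of_ne hp hq, one_apply,
    apply_ite (starRingEnd ℂ)]

/-- Together with `signFlip_mul_torus`, this shows how representatives of the Weyl group normalise
the torus; it is the source of the symmetry of weight multiplicities. -/
theorem ofPerm_mul_torus (σ : Equiv.Perm (Fin g)) (z : Fin g → Circle) :
    ofPerm σ * torus (z ∘ σ) = torus z * ofPerm σ := by
  refine toMatrix_injective ?_
  rw [toMatrix_mul, toMatrix_mul, toMatrix_torus, toMatrix_torus]
  ext i j
  rw [mul_diagonal, diagonal_mul]
  change fromBlocks _ _ _ _ i j * _ = _ * fromBlocks _ _ _ _ i j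
  rcases i with i | i <;> rcases j with j | j <;>
    simp [PEquiv.toMatrix_apply, Equiv.toPEquiv_apply, Equiv.symm_apply_eq]
  all_goals split_ifs with h <;> simp [h]

theorem signFlip_mul_torus (P : Finset (Fin g)) (z : Fin g → Circle) :
    signFlip P * torus (fun k => if k ∈ P then (z k)⁻¹ else z k) = torus z * signFlip P := by
  refine toMatrix_injective ?_
  rw [toMatrix_mul, toMatrix_mul, toMatrix_torus, toMatrix_torus]
  ext i j
  rw [mul_diagonal, diagonal_mul]
  change fromBlocks _ _ _ _ i j * _ = _ * fromBlocks _ _ _ _ i j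
  rcases i with i | i <;> rcases j with j | j <;> by_cases hij : i = j
  all_goals first | subst hij | skip
  all_goals simp [*]
  all_goals split_ifs <;> simp

/-! ### Every element is conjugate to an element of the torus -/

/-- The quaternionic structure `v ↦ J v̄`. -/
def tau (v : Fin g ⊕ Fin g → ℂ) : Fin g ⊕ Fin g → ℂ := J (Fin g) ℂ *ᵥ star v

theorem J_mul_J : J (Fin g) ℂ * J (Fin g) ℂ = -1 := J_squared (Fin g) ℂ

theorem toMatrix_mul_J (x : USp g) :
    toMatrix x * J (Fin g) ℂ = J (Fin g) ℂ * (toMatrix x).map (starRingEnd ℂ) := by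
  have h1 : (toMatrix x)ᵀ * (toMatrix x).map (starRingEnd ℂ) = 1 := by
    have := congrArg transpose (conjTranspose_mul_toMatrix x)
    rwa [transpose_mul, transpose_one] at this
  calc toMatrix x * J (Fin g) ℂ
      = toMatrix x * J (Fin g) ℂ * ((toMatrix x)ᵀ * (toMatrix x).map (starRingEnd ℂ)) := by
        rw [h1, mul_one]
    _ = _ := by rw [← mul_assoc, toMatrix_mul_J_mul_transpose]

/-- Elements of the group are quaternion-linear. As `tau` is antilinear, it carries an eigenvector
for `c` to one for the conjugate of `c`. -/
theorem mulVec_tau (x : USp g) (v : Fin g ⊕ Fin g → ℂ) :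
    toMatrix x *ᵥ tau v = tau (toMatrix x *ᵥ v) := by
  have h1 : star (toMatrix x *ᵥ v) = (toMatrix x).map (starRingEnd ℂ) *ᵥ star v := by
    funext i
    simp [mulVec, dotProduct, star_sum]
  rw [tau, tau, mulVec_mulVec, toMatrix_mul_J, h1, mulVec_mulVec]

theorem tau_smul (c : ℂ) (v : Fin g ⊕ Fin g → ℂ) : tau (c • v) = star c • tau v := by
  rw [tau, tau, star_smul, mulVec_smul]

theorem tau_tau (v : Fin g ⊕ Fin g → ℂ) : tau (tau v) = -v := by
  have h1 : star (J (Fin g) ℂ *ᵥ star v) = J (Fin g) ℂ *ᵥ v := by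
    funext i
    rcases i with i | i <;>
      simp [J, mulVec, dotProduct, fromBlocks, Fintype.sum_sum_type, one_apply]
  rw [tau, tau, h1, mulVec_mulVec, J_mul_J, neg_mulVec, one_mulVec]

theorem star_tau_dotProduct_tau (u v : Fin g ⊕ Fin g → ℂ) :
    star (tau u) ⬝ᵥ tau v = star (star u ⬝ᵥ v) := by
  simp [tau, J, mulVec, dotProduct, fromBlocks, Fintype.sum_sum_type, one_apply, mul_comm,
    add_comm]

theorem star_tau_dotProduct (u v : Fin g ⊕ Fin g → ℂ) :
    star (tau u) ⬝ᵥ v = - star (star u ⬝ᵥ tau v) := by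
  simp [tau, J, mulVec, dotProduct, fromBlocks, Fintype.sum_sum_type, one_apply, mul_comm,
    add_comm]

theorem star_dotProduct_tau_self (v : Fin g ⊕ Fin g → ℂ) : star v ⬝ᵥ tau v = 0 := by
  simp [tau, J, mulVec, dotProduct, fromBlocks, Fintype.sum_sum_type, one_apply, mul_comm]

theorem star_mulVec_dotProduct_mulVec (x : USp g) (u v : Fin g ⊕ Fin g → ℂ) :
    star (toMatrix x *ᵥ u) ⬝ᵥ (toMatrix x *ᵥ v) = star u ⬝ᵥ v := by
  rw [star_mulVec, dotProduct_mulVec, vecMul_vecMul, conjTranspose_mul_toMatrix, vecMul_one]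

theorem star_mul_self_of_mulVec_eq_smul {x : USp g} {v : Fin g ⊕ Fin g → ℂ} {c : ℂ}
    (h : toMatrix x *ᵥ v = c • v) (hv : star v ⬝ᵥ v = 1) : star c * c = 1 := by
  have h1 := star_mulVec_dotProduct_mulVec x v v
  rwa [h, star_smul, smul_dotProduct, dotProduct_smul, hv, smul_eq_mul, smul_eq_mul, mul_one] at h1

theorem star_dotProduct_mulVec_eq_zero {x : USp g} {u v : Fin g ⊕ Fin g → ℂ} {c : ℂ}
    (h : toMatrix x *ᵥ v = c • v) (hc : star c * c = 1) (hu : star v ⬝ᵥ u = 0) :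
    star v ⬝ᵥ (toMatrix x *ᵥ u) = 0 := by
  have h1 := star_mulVec_dotProduct_mulVec x v u
  rw [h, star_smul, smul_dotProduct, hu, smul_eq_mul] at h1
  exact (mul_eq_zero.mp h1).resolve_left fun h0 => by simp [h0] at hc

open scoped ComplexOrder in
-- The map `B` packages fewer than `2g` linear conditions; its kernel is nonzero and stable under
-- `x`, so it contains an eigenvector, which is then normalised.
theorem exists_unit_eigenvector (x : USp g) {n : Type*} [Fintype n]
    (B : (Fin g ⊕ Fin g → ℂ) →ₗ[ℂ] n → ℂ) (hn : Fintype.card n < 2 * g)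
    (hB : ∀ u, B u = 0 → B (toMatrix x *ᵥ u) = 0) :
    ∃ (u : Fin g ⊕ Fin g → ℂ) (c : ℂ), B u = 0 ∧ toMatrix x *ᵥ u = c • u ∧ star u ⬝ᵥ u = 1 := by
  have hker : LinearMap.ker B ≠ ⊥ := by
    refine LinearMap.ker_ne_bot_of_finrank_lt ?_
    simp only [finrank_fintype_fun_eq_card, Fintype.card_sum, Fintype.card_fin]
    omega
  let f : End ℂ (LinearMap.ker B) := (toLin' (toMatrix x)).restrict (p := LinearMap.ker B)
    (q := LinearMap.ker B) fun u hu => by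
      rw [LinearMap.mem_ker] at hu ⊢
      exact hB u hu
  have := Submodule.nontrivial_iff_ne_bot.mpr hker
  obtain ⟨c, hc⟩ := End.exists_eigenvalue f
  obtain ⟨⟨u, hu⟩, hu1, hu2⟩ := hc.exists_hasEigenvector
  have hu3 : toMatrix x *ᵥ u = c • u := congrArg Subtype.val (End.mem_eigenspace_iff.mp hu1)
  have hu0 : u ≠ 0 := fun h => hu2 (Subtype.ext h)
  have hpos : 0 < star u ⬝ᵥ u := dotProduct_star_self_pos_iff.mpr hu0
  obtain ⟨r, hr, hr2⟩ : ∃ r : ℝ, r ≠ 0 ∧ star u ⬝ᵥ u = (r : ℂ) * r := by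
    obtain ⟨h1, h2⟩ := Complex.pos_iff.mp hpos
    refine ⟨√(star u ⬝ᵥ u).re, (Real.sqrt_pos.mpr h1).ne', ?_⟩
    rw [← Complex.ofReal_mul, Real.mul_self_sqrt h1.le]
    exact Complex.ext rfl h2.symm
  have hr' : (r : ℂ) ≠ 0 := Complex.ofReal_ne_zero.mpr hr
  refine ⟨(r : ℂ)⁻¹ • u, c, ?_, ?_, ?_⟩
  · rw [map_smul, LinearMap.mem_ker.mp hu, smul_zero]
  · rw [mulVec_smul, hu3, smul_comm]
  · rw [star_smul, smul_dotProduct, dotProduct_smul, hr2]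
    simp
    field_simp

/-- The spectral theorem over the quaternions, one index at a time: the next eigenvector is taken
orthogonal to every earlier `v k` and `tau (v k)`. Then its image under `tau` is orthogonal to them
as well, and to the vector itself because `J` is antisymmetric. -/
theorem exists_eigenbasis (x : USp g) (s : Finset (Fin g)) :
    ∃ (v : Fin g → Fin g ⊕ Fin g → ℂ) (c : Fin g → ℂ),
      (∀ k ∈ s, toMatrix x *ᵥ v k = c k • v k) ∧
      (∀ j ∈ s, ∀ k ∈ s, star (v j) ⬝ᵥ v k = if j = k then 1 else 0) ∧
      ∀ j ∈ s, ∀ k ∈ s, star (v j) ⬝ᵥ tau (v k) = 0 := by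
  induction s using Finset.induction_on with
  | empty => exact ⟨0, 0, by simp, by simp, by simp⟩
  | insert a s ha ih =>
    obtain ⟨v, c, h1, h2, h3⟩ := ih
    have hc : ∀ k ∈ s, star (c k) * c k = 1 := fun k hk =>
      star_mul_self_of_mulVec_eq_smul (h1 k hk) (by rw [h2 k hk k hk, if_pos rfl])
    let B : (Fin g ⊕ Fin g → ℂ) →ₗ[ℂ] (s ⊕ s) → ℂ := LinearMap.pi
      (Sum.elim (fun k => dotProductBilin ℂ ℂ (star (v k)))
        fun k => dotProductBilin ℂ ℂ (star (tau (v k))))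
    have hBu : ∀ u, B u = 0 ↔ (∀ k ∈ s, star (v k) ⬝ᵥ u = 0) ∧
        ∀ k ∈ s, star (tau (v k)) ⬝ᵥ u = 0 := by
      intro u
      constructor
      · exact fun h => ⟨fun k hk => congrFun h (Sum.inl ⟨k, hk⟩),
          fun k hk => congrFun h (Sum.inr ⟨k, hk⟩)⟩
      · rintro ⟨h, h'⟩
        funext k
        rcases k with k | k
        · exact h k k.2
        · exact h' k k.2
    obtain ⟨u, d, hu0, hu1, hu2⟩ := exists_unit_eigenvector x B
      (by
        have := Finset.card_lt_card (Finset.ssubset_univ_iff.mpr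
          (fun h => ha (h ▸ Finset.mem_univ a) : s ≠ Finset.univ))
        simp only [Finset.card_univ, Fintype.card_fin] at this
        simp only [Fintype.card_sum, Fintype.card_coe]
        omega)
      (by
        intro u hu
        rw [hBu] at hu ⊢
        refine ⟨fun k hk => star_dotProduct_mulVec_eq_zero (h1 k hk) (hc k hk) (hu.1 k hk),
          fun k hk => star_dotProduct_mulVec_eq_zero (c := star (c k)) ?_ ?_ (hu.2 k hk)⟩
        · rw [mulVec_tau, h1 k hk, tau_smul]
        · rw [star_star, mul_comm, hc k hk])
    rw [hBu] at hu0
    have hne : ∀ k ∈ s, k ≠ a := fun k hk h => ha (h ▸ hk)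
    refine ⟨Function.update v a u, Function.update c a d, ?_, ?_, ?_⟩
    · intro k hk
      rcases Finset.mem_insert.mp hk with hk' | hk'
      · simpa [hk'] using hu1
      · simpa [hne k hk'] using h1 k hk'
    · intro j hj k hk
      rcases Finset.mem_insert.mp hj with hj' | hj' <;>
        rcases Finset.mem_insert.mp hk with hk' | hk'
      · simpa [hj', hk'] using hu2
      · have : star u ⬝ᵥ v k = 0 := by rw [star_dotProduct, hu0.1 k hk', star_zero]
        simpa [hj', hne k hk', (hne k hk').symm] using this
      · simpa [hk', hne j hj'] using hu0.1 j hj'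
      · simpa [hne k hk', hne j hj'] using h2 j hj' k hk'
    · intro j hj k hk
      rcases Finset.mem_insert.mp hj with hj' | hj' <;>
        rcases Finset.mem_insert.mp hk with hk' | hk'
      · simpa [hj', hk'] using star_dotProduct_tau_self u
      · have : star u ⬝ᵥ tau (v k) = 0 := by rw [star_dotProduct, hu0.2 k hk', star_zero]
        simpa [hj', hne k hk'] using this
      · have h4 := star_tau_dotProduct (v j) u
        rw [hu0.2 j hj', zero_eq_neg, star_eq_zero] at h4
        simpa [hk', hne j hj'] using h4
      · simpa [hne k hk', hne j hj'] using h3 j hj' k hk'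

theorem exists_eq_conj_torus (x : USp g) : ∃ (y : USp g) (z : Fin g → Circle),
    x = y * torus z * y⁻¹ := by
  obtain ⟨v, c, h1, h2, h3⟩ := exists_eigenbasis x Finset.univ
  simp only [Finset.mem_univ, true_imp_iff] at h1 h2 h3
  have hc : ∀ k, star (c k) * c k = 1 := fun k =>
    star_mul_self_of_mulVec_eq_smul (h1 k) (by rw [h2 k k, if_pos rfl])
  -- The columns are the `v k` followed by the `tau (v k)`. Orthonormality makes `Y` unitary, and
  -- compatibility with `tau` makes it symplectic.
  let Y : Matrix (Fin g ⊕ Fin g) (Fin g ⊕ Fin g) ℂ :=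
    (Matrix.of (Sum.elim v fun k => tau (v k)))ᵀ
  have hYl : ∀ k, Y.col (Sum.inl k) = v k := fun _ => rfl
  have hYr : ∀ k, Y.col (Sum.inr k) = tau (v k) := fun _ => rfl
  have hY : Yᴴ * Y = 1 := by
    ext i j
    have : (Yᴴ * Y) i j = star (Y.col i) ⬝ᵥ Y.col j := rfl
    rw [this, one_apply]
    rcases i with i | i <;> rcases j with j | j
    · simp [hYl, h2]
    · simp [hYl, hYr, h3]
    · simp [hYl, hYr, star_tau_dotProduct, h3]
    · rw [hYr, hYr, star_tau_dotProduct_tau, h2]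
      by_cases h : i = j
      · simp [h]
      · simp [h]
  have hY' : Y * Yᴴ = 1 := mul_eq_one_comm.mp hY
  have hYJ : Y * J (Fin g) ℂ = J (Fin g) ℂ * Y.map (starRingEnd ℂ) := by
    ext i j
    have hr : (J (Fin g) ℂ * Y.map (starRingEnd ℂ)) i j = tau (Y.col j) i := rfl
    rw [hr]
    rcases j with j | j
    · rw [hYl]
      simp [mul_apply, J, Fintype.sum_sum_type, one_apply, Y]
    · rw [hYr, tau_tau]
      simp [mul_apply, J, Fintype.sum_sum_type, one_apply, Y]
  have hYJ' : Y * J (Fin g) ℂ * Yᵀ = J (Fin g) ℂ := by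
    have h4 : Y.map (starRingEnd ℂ) * Yᵀ = 1 := by
      have := congrArg transpose hY'
      rwa [transpose_mul, transpose_one] at this
    rw [hYJ, mul_assoc, h4, mul_one]
  have hz : ∀ k, ∃ z : Circle, (z : ℂ) = c k := fun k => by
    have hn : ‖c k‖ = 1 := by
      have := congrArg (fun w : ℂ => ‖w‖) (hc k)
      simp only [norm_mul, norm_star, norm_one] at this
      nlinarith [norm_nonneg (c k)]
    exact ⟨⟨c k, mem_sphere_zero_iff_norm.mpr hn⟩, rfl⟩
  choose z hz using hz
  refine ⟨ofMatrix Y hY' hYJ', z, ?_⟩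
  rw [eq_mul_inv_iff_mul_eq]
  refine toMatrix_injective ?_
  rw [toMatrix_mul, toMatrix_mul, toMatrix_ofMatrix, toMatrix_torus]
  ext i j
  have hl : (toMatrix x * Y) i j = (toMatrix x *ᵥ Y.col j) i := rfl
  rw [hl, mul_diagonal]
  rcases j with j | j
  · rw [hYl, h1]
    simp [Y, mul_comm, hz]
  · rw [hYr, mulVec_tau, h1, tau_smul, Sum.elim_inr, Circle.coe_inv_eq_conj, hz]
    simp [Y, mul_comm]

end USp

end

/-! ### The invariant two-form and its adjoint on the exterior algebra -/

noncomputable section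

open Module Matrix

namespace USp

variable {g : ℕ}

/-! ### The exterior algebra of the standard representation -/

variable (g) in
/-- The exterior algebra of the standard representation. -/
abbrev ExtAlg : Type := ExteriorAlgebra ℂ (Fin g ⊕ Fin g → ℂ)

/-- The basis vectors, as elements of the exterior algebra. -/
def extVec (s : Fin g ⊕ Fin g) : ExtAlg g := ExteriorAlgebra.ι ℂ (Pi.single s 1)

/-- The action of `USp(2g)` on the exterior algebra. -/
def extAct (x : USp g) : ExtAlg g →ₐ[ℂ] ExtAlg g := ExteriorAlgebra.map (standardRep g x)

/-- Products of basis vectors. -/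
def extProd (l : List (Fin g ⊕ Fin g)) : ExtAlg g := (l.map extVec).prod

variable (g) in
/-- The invariant element of degree two. -/
def extOmega : ExtAlg g := ∑ p, extVec (Sum.inl p) * extVec (Sum.inr p)

theorem extAct_extVec (x : USp g) (s : Fin g ⊕ Fin g) :
    extAct x (extVec s) = ExteriorAlgebra.ι ℂ (standardRep g x (Pi.single s 1)) :=
  ExteriorAlgebra.map_apply_ι _ _

theorem extAct_extVec_eq_sum (x : USp g) (s : Fin g ⊕ Fin g) :
    extAct x (extVec s) = ∑ t, toMatrix x t s • extVec t := by
  have : standardRep g x (Pi.single s 1) = ∑ t, toMatrix x t s • Pi.single t (1 : ℂ) := by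
    rw [standardRep_single]
    exact (pi_eq_sum_univ' _).trans (by simp [Pi.single])
  rw [extAct_extVec, this, map_sum]
  simp only [map_smul]
  rfl

theorem extAct_mul_apply (x y : USp g) (u : ExtAlg g) :
    extAct (x * y) u = extAct x (extAct y u) := by
  rw [extAct, map_mul]
  exact (AlgHom.congr_fun (ExteriorAlgebra.map_comp_map (standardRep g y) (standardRep g x)) u).symm

theorem ι_mul_ι_comm (v w : Fin g ⊕ Fin g → ℂ) :
    ExteriorAlgebra.ι ℂ v * ExteriorAlgebra.ι ℂ w =
      -(ExteriorAlgebra.ι ℂ w * ExteriorAlgebra.ι ℂ v) :=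
  eq_neg_of_add_eq_zero_left (ExteriorAlgebra.ι_add_mul_swap v w)

theorem extVec_mul_comm (s t : Fin g ⊕ Fin g) : extVec s * extVec t = -(extVec t * extVec s) :=
  ι_mul_ι_comm _ _

theorem extVec_mul_self (s : Fin g ⊕ Fin g) : extVec s * extVec s = 0 :=
  ExteriorAlgebra.ι_sq_zero _

/-- Writing `ω` through the entries of `J` reduces its invariance to `x J xᵀ = J`. Each plane
contributes twice, with the sign of the upper right block of `J`, whence `-2`. -/
theorem sum_J_smul_mul (u : Fin g ⊕ Fin g → ExtAlg g)
    (hu : ∀ p, u (Sum.inr p) * u (Sum.inl p) = -(u (Sum.inl p) * u (Sum.inr p))) :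
    ∑ a, ∑ b, J (Fin g) ℂ a b • (u a * u b) =
      (-2 : ℂ) • ∑ p, u (Sum.inl p) * u (Sum.inr p) := by
  simp only [Fintype.sum_sum_type, J, fromBlocks_apply₁₁, fromBlocks_apply₁₂, fromBlocks_apply₂₁,
    fromBlocks_apply₂₂, Matrix.zero_apply, zero_smul, Finset.sum_const_zero, add_zero, zero_add,
    Matrix.neg_apply, one_apply, neg_smul, ite_smul, one_smul, Finset.sum_neg_distrib,
    Finset.sum_ite_eq, Finset.mem_univ, if_true, hu]
  rw [two_smul]
  abel

theorem sum_reverse {ι M : Type*} [Fintype ι] [AddCommMonoid M] (F : ι → ι → ι → ι → M) :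
    ∑ a, ∑ b, ∑ d, ∑ c, F a b d c = ∑ c, ∑ d, ∑ b, ∑ a, F a b d c := by
  calc _ = ∑ a, ∑ b, ∑ c, ∑ d, F a b d c :=
        Finset.sum_congr rfl fun a _ => Finset.sum_congr rfl fun b _ => Finset.sum_comm
    _ = ∑ a, ∑ c, ∑ b, ∑ d, F a b d c := Finset.sum_congr rfl fun a _ => Finset.sum_comm
    _ = ∑ c, ∑ a, ∑ b, ∑ d, F a b d c := Finset.sum_comm
    _ = ∑ c, ∑ a, ∑ d, ∑ b, F a b d c :=
        Finset.sum_congr rfl fun a _ => Finset.sum_congr rfl fun b _ => Finset.sum_comm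
    _ = ∑ c, ∑ d, ∑ a, ∑ b, F a b d c := Finset.sum_congr rfl fun a _ => Finset.sum_comm
    _ = _ := Finset.sum_congr rfl fun a _ => Finset.sum_congr rfl fun b _ => Finset.sum_comm

theorem extAct_extOmega (x : USp g) : extAct x (extOmega g) = extOmega g := by
  have h1 := sum_J_smul_mul (g := g) extVec fun p => extVec_mul_comm _ _
  have h2 := sum_J_smul_mul (g := g) (fun s => extAct x (extVec s)) fun p => by
    rw [← map_mul, extVec_mul_comm, map_neg, map_mul]
  have h3 : ∑ a, ∑ b, J (Fin g) ℂ a b • (extAct x (extVec a) * extAct x (extVec b)) =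
      ∑ c, ∑ d, (toMatrix x * J (Fin g) ℂ * (toMatrix x)ᵀ) c d • (extVec c * extVec d) := by
    simp only [extAct_extVec_eq_sum, Finset.sum_mul, Finset.mul_sum, smul_mul_assoc, mul_smul_comm,
      Finset.smul_sum, smul_smul, mul_apply, transpose_apply, Finset.sum_smul]
    refine (sum_reverse _).trans ?_
    refine Finset.sum_congr rfl fun c _ => Finset.sum_congr rfl fun d _ =>
      Finset.sum_congr rfl fun b _ => Finset.sum_congr rfl fun a _ => ?_
    congr 1
    ring
  rw [toMatrix_mul_J_mul_transpose] at h3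
  have h4 : (-2 : ℂ) • extAct x (extOmega g) = (-2 : ℂ) • extOmega g := by
    rw [extOmega, map_sum]
    simp only [map_mul]
    rw [← h1, ← h2, h3]
  exact smul_right_injective _ (by norm_num : (-2 : ℂ) ≠ 0) h4

/-! ### Contractions -/

/-- Contraction with the dual basis vectors. -/
def contr (s : Fin g ⊕ Fin g) : ExtAlg g →ₗ[ℂ] ExtAlg g :=
  CliffordAlgebra.contractLeft (LinearMap.proj s : Dual ℂ (Fin g ⊕ Fin g → ℂ))

theorem contr_ι_mul (s : Fin g ⊕ Fin g) (v : Fin g ⊕ Fin g → ℂ) (y : ExtAlg g) :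
    contr s (ExteriorAlgebra.ι ℂ v * y) = v s • y - ExteriorAlgebra.ι ℂ v * contr s y :=
  CliffordAlgebra.contractLeft_ι_mul _ _ _

theorem contr_extVec_mul (s t : Fin g ⊕ Fin g) (y : ExtAlg g) :
    contr s (extVec t * y) = (if s = t then y else 0) - extVec t * contr s y := by
  rw [extVec, contr_ι_mul, Pi.single_apply, ite_smul, one_smul, zero_smul]

theorem contr_mem (s : Fin g ⊕ Fin g) (d : ℕ) : ∀ y ∈ ⋀[ℂ]^(d + 1) (Fin g ⊕ Fin g → ℂ),
    contr s y ∈ ⋀[ℂ]^d (Fin g ⊕ Fin g → ℂ) := by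
  induction d with
  | zero =>
    intro y hy
    rw [zero_add, ExteriorAlgebra.exteriorPower, pow_one] at hy
    obtain ⟨v, rfl⟩ := hy
    rw [ExteriorAlgebra.exteriorPower, pow_zero]
    have := contr_ι_mul s v 1
    rw [mul_one, contr, CliffordAlgebra.contractLeft_one, mul_zero, sub_zero] at this
    rw [contr, this]
    exact Submodule.smul_mem _ _ (Submodule.mem_one.mpr ⟨1, map_one _⟩)
  | succ d ih =>
    intro y hy
    rw [ExteriorAlgebra.exteriorPower, pow_succ'] at hy
    induction hy using Submodule.mul_induction_on' with
    | mem_mul_mem m hm n hn =>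
      obtain ⟨v, rfl⟩ := hm
      rw [contr_ι_mul]
      refine Submodule.sub_mem _ (Submodule.smul_mem _ _ hn) ?_
      rw [ExteriorAlgebra.exteriorPower, pow_succ']
      exact Submodule.mul_mem_mul ⟨v, rfl⟩ (ih n hn)
    | add a _ b _ ha hb =>
      rw [map_add]
      exact Submodule.add_mem _ ha hb

theorem contr_eq_zero (s : Fin g ⊕ Fin g) {y : ExtAlg g}
    (hy : y ∈ ⋀[ℂ]^0 (Fin g ⊕ Fin g → ℂ)) : contr s y = 0 := by
  rw [ExteriorAlgebra.exteriorPower, pow_zero, Submodule.mem_one] at hy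
  obtain ⟨c, rfl⟩ := hy
  exact CliffordAlgebra.contractLeft_algebraMap (Q := (0 : QuadraticForm ℂ (Fin g ⊕ Fin g → ℂ)))
    (LinearMap.proj s) c

/-- Euler's identity for the exterior algebra: this operator is a derivation that fixes vectors of
degree one, so it acts as the degree. -/
theorem sum_extVec_mul_contr (d : ℕ) : ∀ y ∈ ⋀[ℂ]^d (Fin g ⊕ Fin g → ℂ),
    ∑ s, extVec s * contr s y = (d : ℂ) • y := by
  induction d with
  | zero =>
    intro y hy
    simp [contr_eq_zero _ hy]
  | succ d ih =>
    intro y hy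
    rw [ExteriorAlgebra.exteriorPower, pow_succ'] at hy
    induction hy using Submodule.mul_induction_on' with
    | mem_mul_mem m hm n hn =>
      obtain ⟨v, rfl⟩ := hm
      have h1 : ∑ s, v s • extVec s = ExteriorAlgebra.ι ℂ v := by
        conv_rhs => rw [pi_eq_sum_univ' v, map_sum]
        refine Finset.sum_congr rfl fun s _ => ?_
        rw [map_smul, extVec]
      have h2 : ∀ s, extVec s * contr s (ExteriorAlgebra.ι ℂ v * n) =
          (v s • extVec s) * n + ExteriorAlgebra.ι ℂ v * (extVec s * contr s n) := by
        intro s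
        rw [contr_ι_mul, mul_sub, ← mul_assoc, ← mul_assoc, extVec, ι_mul_ι_comm v, mul_smul_comm,
          smul_mul_assoc, neg_mul, sub_eq_add_neg]
      simp only [h2]
      rw [Finset.sum_add_distrib, ← Finset.sum_mul, h1, ← Finset.mul_sum, ih n hn]
      rw [mul_smul_comm]
      push_cast
      rw [add_smul, one_smul, add_comm]
    | add a _ b _ ha hb =>
      simp only [map_add, mul_add, Finset.sum_add_distrib, smul_add, ha, hb]

variable (g) in
/-- The operator adjoint to multiplication by `extOmega`. -/
def contrOmega : ExtAlg g →ₗ[ℂ] ExtAlg g :=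
  ∑ p, contr (Sum.inr p) ∘ₗ contr (Sum.inl p)

theorem contrOmega_apply (y : ExtAlg g) :
    contrOmega g y = ∑ p, contr (Sum.inr p) (contr (Sum.inl p) y) := by
  simp [contrOmega]

theorem contr_inl_extOmega_mul (p : Fin g) (y : ExtAlg g) :
    contr (Sum.inl p) (extOmega g * y) =
      extVec (Sum.inr p) * y + extOmega g * contr (Sum.inl p) y := by
  simp only [extOmega, Finset.sum_mul, map_sum, mul_assoc, contr_extVec_mul, Sum.inl.injEq,
    reduceCtorEq, if_false, zero_sub, mul_neg, sub_neg_eq_add, Finset.sum_add_distrib,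
    Finset.sum_ite_eq, Finset.mem_univ, if_true]

theorem contr_inr_extOmega_mul (p : Fin g) (y : ExtAlg g) :
    contr (Sum.inr p) (extOmega g * y) =
      -(extVec (Sum.inl p) * y) + extOmega g * contr (Sum.inr p) y := by
  simp only [extOmega, Finset.sum_mul, map_sum, mul_assoc, contr_extVec_mul, Sum.inr.injEq,
    reduceCtorEq, if_false, zero_sub, mul_sub, neg_sub, Finset.sum_sub_distrib, mul_ite, mul_zero,
    Finset.sum_ite_eq, Finset.mem_univ, if_true]
  abel

/-- The `sl₂` relation: the commutator of contraction by `ω` with multiplication by `ω` is `g` minus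
the degree operator. -/
theorem contrOmega_extOmega_mul (y : ExtAlg g) :
    contrOmega g (extOmega g * y) =
      (g : ℂ) • y - ∑ s, extVec s * contr s y + extOmega g * contrOmega g y := by
  have h1 : ∀ p : Fin g, contr (Sum.inr p) (contr (Sum.inl p) (extOmega g * y)) =
      y - extVec (Sum.inr p) * contr (Sum.inr p) y - extVec (Sum.inl p) * contr (Sum.inl p) y +
        extOmega g * contr (Sum.inr p) (contr (Sum.inl p) y) := by
    intro p
    rw [contr_inl_extOmega_mul, map_add, contr_inr_extOmega_mul, contr_extVec_mul, if_pos rfl]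
    abel
  rw [contrOmega_apply, contrOmega_apply]
  simp only [h1, Finset.sum_add_distrib, Finset.sum_sub_distrib, Finset.sum_const,
    Finset.card_univ, Fintype.card_fin, ← Finset.mul_sum, Fintype.sum_sum_type]
  rw [← Nat.cast_smul_eq_nsmul ℂ]
  abel

/-- Each contraction lowers the degree by two; the first alternative covers the case in which the
degree would become negative. -/
theorem contrOmega_pow_mem (m : ℕ) : ∀ (d : ℕ), ∀ y ∈ ⋀[ℂ]^d (Fin g ⊕ Fin g → ℂ),
    (contrOmega g ^ m) y = 0 ∨
      ∃ d', d' + 2 * m = d ∧ (contrOmega g ^ m) y ∈ ⋀[ℂ]^d' (Fin g ⊕ Fin g → ℂ) := by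
  induction m with
  | zero => exact fun d y hy => Or.inr ⟨d, by simp, by simpa using hy⟩
  | succ m ih =>
    intro d y hy
    rw [pow_succ, Module.End.mul_apply]
    match d with
    | 0 =>
      left
      rw [contrOmega_apply]
      simp [contr_eq_zero _ hy]
    | 1 =>
      left
      rw [contrOmega_apply]
      simp [contr_eq_zero _ (contr_mem _ 0 _ hy)]
    | d + 2 =>
      have : contrOmega g y ∈ ⋀[ℂ]^d (Fin g ⊕ Fin g → ℂ) := by
        rw [contrOmega_apply]
        exact Submodule.sum_mem _ fun p _ => contr_mem _ _ _ (contr_mem _ _ _ hy)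
      refine (ih d _ this).imp_right ?_
      rintro ⟨d', hd, h⟩
      exact ⟨d', by omega, h⟩

/-- The `k`-th contraction of `y` has degree `d - 2k`, so its commutator contributes `g - d + 2k`;
summing over `k = 0, …, m` gives `(m + 1)(g - d + m)`. -/
theorem contrOmega_pow_extOmega_mul {d : ℕ} {y : ExtAlg g}
    (hy : y ∈ ⋀[ℂ]^d (Fin g ⊕ Fin g → ℂ)) (m : ℕ) :
    (contrOmega g ^ (m + 1)) (extOmega g * y) =
      extOmega g * (contrOmega g ^ (m + 1)) y +
        ((m + 1) * (g - d + m) : ℂ) • (contrOmega g ^ m) y := by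
  have hN : ∀ m : ℕ, ∑ s, extVec s * contr s ((contrOmega g ^ m) y) =
      (d - 2 * m : ℂ) • (contrOmega g ^ m) y := by
    intro m
    rcases contrOmega_pow_mem m d y hy with h | ⟨d', hd, h⟩
    · simp [h]
    · rw [sum_extVec_mul_contr d' _ h, ← hd]
      push_cast
      congr 1
      ring
  induction m with
  | zero =>
    have := hN 0
    simp only [pow_zero, Module.End.one_apply] at this
    rw [zero_add, pow_one, contrOmega_extOmega_mul, this, pow_zero, Module.End.one_apply]
    push_cast
    module
  | succ m ih =>
    rw [pow_succ', Module.End.mul_apply, ih, map_add, map_smul, contrOmega_extOmega_mul, hN,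
      ← Module.End.mul_apply, ← Module.End.mul_apply, ← pow_succ', ← pow_succ']
    push_cast
    module

/-- If `ω y = 0`, the commutation formula has a nonzero scalar for `d < g`, so vanishing of one
power of the contraction on `y` implies vanishing of the previous power. The descent starts at the
power `d + 1`, which kills `y` for degree reasons. -/
theorem eq_zero_of_extOmega_mul_eq_zero {d : ℕ} (hd : d < g) {y : ExtAlg g}
    (hy : y ∈ ⋀[ℂ]^d (Fin g ⊕ Fin g → ℂ)) (h : extOmega g * y = 0) : y = 0 := by
  have hdesc : ∀ m, (contrOmega g ^ m) y = 0 → y = 0 := by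
    intro m
    induction m with
    | zero => exact fun h => h
    | succ m ih =>
      intro hm
      refine ih ?_
      have h1 := contrOmega_pow_extOmega_mul hy m
      rw [h, hm, map_zero, mul_zero, zero_add] at h1
      refine (smul_eq_zero.mp h1.symm).resolve_left ?_
      have h2 : ((m + 1) * (g - d + m) : ℂ) = (((m + 1) * (g - d + m) : ℕ) : ℂ) := by
        push_cast [Nat.cast_sub hd.le]
        ring
      rw [h2]
      refine Nat.cast_ne_zero.mpr ?_
      have : 0 < g - d := by omega
      positivity
  refine hdesc (d + 1) ((contrOmega_pow_mem (d + 1) d y hy).resolve_right ?_)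
  rintro ⟨d', h1, -⟩
  omega

end USp

end

/-! ### Exterior powers: generators, continuity, characters -/

noncomputable section

open Module Matrix

namespace USp

variable {g : ℕ}

/-! ### Generation of the exterior powers -/

/-- The coordinate plane to which a basis vector belongs. -/
abbrev planeIndex (s : Fin g ⊕ Fin g) : Fin g := Sum.elim id id s

theorem extProd_cons (s : Fin g ⊕ Fin g) (l : List (Fin g ⊕ Fin g)) :
    extProd (s :: l) = extVec s * extProd l := by
  simp [extProd]

theorem extVec_mul_extProd_eq_zero {s : Fin g ⊕ Fin g} {l : List (Fin g ⊕ Fin g)} (h : s ∈ l) :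
    extVec s * extProd l = 0 := by
  induction l with
  | nil => simp at h
  | cons t l ih =>
    rw [extProd_cons, ← mul_assoc]
    rcases List.mem_cons.mp h with rfl | h
    · rw [extVec_mul_self, zero_mul]
    · rw [extVec_mul_comm, neg_mul, mul_assoc, ih h, mul_zero, neg_zero]

theorem extProd_eq_zero {l : List (Fin g ⊕ Fin g)} (h : ¬ l.Nodup) : extProd l = 0 := by
  induction l with
  | nil => simp at h
  | cons t l ih =>
    rw [extProd_cons]
    by_cases ht : t ∈ l
    · exact extVec_mul_extProd_eq_zero ht
    · rw [ih fun hl => h (List.nodup_cons.mpr ⟨ht, hl⟩), mul_zero]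

theorem extProd_perm {l l' : List (Fin g ⊕ Fin g)} (h : l.Perm l') :
    extProd l = extProd l' ∨ extProd l = -extProd l' := by
  induction h with
  | nil => exact Or.inl rfl
  | cons s _ ih =>
    rw [extProd_cons, extProd_cons]
    exact ih.imp (fun h => by rw [h]) fun h => by rw [h, mul_neg]
  | swap s t l =>
    right
    rw [extProd_cons, extProd_cons, extProd_cons, extProd_cons, ← mul_assoc, ← mul_assoc,
      extVec_mul_comm, neg_mul]
  | trans _ _ h1 h2 =>
    rcases h1 with h1 | h1 <;> rcases h2 with h2 | h2 <;> simp [h1, h2]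

theorem extAct_extProd (x : USp g) (l : List (Fin g ⊕ Fin g)) :
    extAct x (extProd l) = (l.map fun s => extAct x (extVec s)).prod := by
  rw [extProd, map_list_prod, List.map_map]
  rfl

theorem extAct_extProd_eq_map (x : USp g) (f : Fin g ⊕ Fin g → Fin g ⊕ Fin g)
    (l : List (Fin g ⊕ Fin g)) (h : ∀ s ∈ l, extAct x (extVec s) = extVec (f s)) :
    extAct x (extProd l) = extProd (l.map f) := by
  rw [extAct_extProd, extProd, List.map_map]
  exact congrArg List.prod (List.map_congr_left h)

theorem exists_perm_map_eq {α : Type*} {l l' : List α} (hl : l.Nodup) (hl' : l'.Nodup)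
    (h : l.length = l'.length) : ∃ σ : Equiv.Perm α, l.map σ = l' := by
  obtain ⟨σ, hσ⟩ := MulAction.isMultiplyPretransitive_iff.mp
    (Equiv.Perm.isMultiplyPretransitive α l.length) ⟨l.get, hl.injective_get⟩
    ⟨l'.get ∘ Fin.cast h, hl'.injective_get.comp (Fin.cast_injective h)⟩
  refine ⟨σ, List.ext_get (by simpa using h) fun n h1 h2 => ?_⟩
  have := DFunLike.congr_fun hσ ⟨n, by simpa using h1⟩
  simpa using this

/-- The Weyl group acts transitively on products of basis vectors from distinct planes. -/
theorem exists_extAct_eq_extProd {S : List (Fin g)} (hS : S.Nodup) {l : List (Fin g ⊕ Fin g)}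
    (hl : (l.map planeIndex).Nodup) (h : S.length = l.length) :
    ∃ x : USp g, extAct x (extProd (S.map Sum.inl)) = extProd l := by
  classical
  obtain ⟨σ, hσ⟩ := exists_perm_map_eq hS hl (by simpa using h)
  -- First `σ` moves `S` to the planes met by `l`; then the planes where `l` uses the negative
  -- vector are flipped.
  let P : Finset (Fin g) := Finset.univ.filter fun p => Sum.inr p ∈ l
  have hl2 : (l.map planeIndex).map (fun p => if p ∈ P then Sum.inr p else Sum.inl p) = l := by
    rw [List.map_map]
    conv_rhs => rw [← List.map_id l]
    refine List.map_congr_left fun s hs => ?_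
    rcases s with p | p
    · have : Sum.inr p ∉ l := fun h' => by
        have := List.inj_on_of_nodup_map hl hs h' rfl
        simp at this
      simp [P, this]
    · simp [P, hs]
  refine ⟨signFlip P * ofPerm σ, ?_⟩
  rw [extAct_mul_apply, extAct_extProd_eq_map (ofPerm σ) (Sum.map σ id),
    extAct_extProd_eq_map (signFlip P)
      (Sum.elim (fun p => if p ∈ P then Sum.inr p else Sum.inl p) Sum.inr)]
  · congr 1
    conv_rhs => rw [← hl2, ← hσ]
    simp [List.map_map, Function.comp_def]
  · intro s hs
    obtain ⟨_, hs1, rfl⟩ := List.mem_map.mp hs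
    obtain ⟨p, -, rfl⟩ := List.mem_map.mp hs1
    rw [Sum.map_inl, extAct_extVec, standardRep_signFlip]
    rfl
  · intro s hs
    obtain ⟨p, -, rfl⟩ := List.mem_map.mp hs
    rw [extAct_extVec, standardRep_ofPerm]
    rfl

theorem extOmega_mul_extProd (l : List (Fin g ⊕ Fin g)) :
    extOmega g * extProd l = ∑ p, extProd (Sum.inl p :: Sum.inr p :: l) := by
  simp [extOmega, Finset.sum_mul, extProd_cons, mul_assoc]

/-- The last term, with factor `12/25` (sine times cosine), produces the difference of two full
planes from a product that meets both planes once. -/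
theorem extAct_rotation_extProd {p q : Fin g} (h : p ≠ q) {l : List (Fin g ⊕ Fin g)}
    (hp : p ∉ l.map planeIndex) (hq : q ∉ l.map planeIndex) :
    extAct (rotation h) (extProd (Sum.inl p :: Sum.inr q :: l)) =
      (9 / 25 : ℂ) • extProd (Sum.inl p :: Sum.inr q :: l) -
        (16 / 25 : ℂ) • extProd (Sum.inl q :: Sum.inr p :: l) +
        (12 / 25 : ℂ) • (extProd (Sum.inl q :: Sum.inr q :: l) -
          extProd (Sum.inl p :: Sum.inr p :: l)) := by
  have h1 : extAct (rotation h) (extProd l) = extProd l := by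
    rw [extAct_extProd_eq_map _ id, List.map_id]
    intro s hs
    rw [extAct_extVec, standardRep_rotation_of_ne h]
    · rfl
    · exact fun h' => hp (List.mem_map.mpr ⟨s, hs, h'⟩)
    · exact fun h' => hq (List.mem_map.mpr ⟨s, hs, h'⟩)
  simp only [extProd_cons, map_mul, h1, extAct_extVec, standardRep_rotation_inl_left,
    standardRep_rotation_inr_right, map_add, map_smul]
  simp only [← extVec.eq_1, add_mul, mul_add, smul_mul_assoc, mul_smul_comm]
  module

/-- A submodule of the exterior algebra that is stable under `USp(2g)` and contains the multiples
of `extOmega` of degree `i` and one totally isotropic product contains all products of degree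
`i`. -/
theorem extProd_mem {U : Submodule ℂ (ExtAlg g)} (hU : ∀ x, ∀ y ∈ U, extAct x y ∈ U) {i : ℕ}
    (hω : ∀ l : List (Fin g ⊕ Fin g), l.length + 2 = i → extOmega g * extProd l ∈ U)
    {S : List (Fin g)} (hS : S.Nodup) (hSi : S.length = i) (hSU : extProd (S.map Sum.inl) ∈ U) :
    ∀ l : List (Fin g ⊕ Fin g), l.length = i → extProd l ∈ U := by
  classical
  -- Induction on a bound `n` for the degree minus the number of planes met. When that difference is
  -- zero, all planes are distinct and the Weyl group suffices.
  suffices H : ∀ (n : ℕ) (l : List (Fin g ⊕ Fin g)), l.length = i → l.Nodup →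
      i ≤ (l.map planeIndex).toFinset.card + n → extProd l ∈ U by
    intro l hl
    by_cases hn : l.Nodup
    · exact H i l hl hn (by omega)
    · rw [extProd_eq_zero hn]
      exact U.zero_mem
  intro n
  induction n with
  | zero =>
    intro l hl _ hc
    have hn : (l.map planeIndex).Nodup := by
      rw [← Multiset.coe_nodup, ← Multiset.toFinset_card_eq_card_iff_nodup]
      refine le_antisymm (Multiset.toFinset_card_le _) ?_
      simpa [hl] using hc
    obtain ⟨x, hx⟩ := exists_extAct_eq_extProd hS hn (hSi.trans hl.symm)
    rw [← hx]
    exact hU x _ hSU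
  | succ n ih =>
    intro l hl hnd hc
    by_cases hn : (l.map planeIndex).Nodup
    · obtain ⟨x, hx⟩ := exists_extAct_eq_extProd hS hn (hSi.trans hl.symm)
      rw [← hx]
      exact hU x _ hSU
    obtain ⟨p, hp1, hp2⟩ : ∃ p, Sum.inl p ∈ l ∧ Sum.inr p ∈ l := by
      by_contra hne
      push Not at hne
      refine hn (hnd.map_on fun s hs t ht hst => ?_)
      rcases s with s | s <;> rcases t with t | t <;>
        simp only [planeIndex, Sum.elim_inl, Sum.elim_inr, id] at hst <;> subst hst
      · rfl
      · exact absurd ht (hne _ hs)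
      · exact absurd hs (hne _ ht)
      · rfl
    obtain ⟨l', hl'⟩ : ∃ l', l.Perm (Sum.inl p :: Sum.inr p :: l') := by
      obtain ⟨l₁, l₂, rfl⟩ := List.mem_iff_append.mp hp1
      have h2 : Sum.inr p ∈ l₁ ++ l₂ := by simpa using hp2
      obtain ⟨l₃, l₄, h34⟩ := List.mem_iff_append.mp h2
      refine ⟨l₃ ++ l₄, List.perm_middle.trans (List.Perm.cons _ ?_)⟩
      rw [h34]
      exact List.perm_middle
    suffices hmem : extProd (Sum.inl p :: Sum.inr p :: l') ∈ U by
      rcases extProd_perm hl' with h | h <;> rw [h]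
      · exact hmem
      · exact U.neg_mem hmem
    have hlen : l'.length + 2 = i := by
      rw [← hl, hl'.length_eq]
      rfl
    have hnd' := hl'.nodup_iff.mp hnd
    have hpl : p ∉ l'.map planeIndex := by
      intro h
      obtain ⟨s, hs, hsp⟩ := List.mem_map.mp h
      rcases s with s | s <;> simp only [planeIndex, Sum.elim_inl, Sum.elim_inr, id] at hsp <;>
        subst hsp
      · simp [hs] at hnd'
      · simp [hs] at hnd'
    have hcard : (l.map planeIndex).toFinset.card = (l'.map planeIndex).toFinset.card + 1 := by
      rw [List.toFinset_eq_of_perm _ _ (hl'.map planeIndex)]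
      simp only [List.map_cons, planeIndex, Sum.elim_inl, Sum.elim_inr, id, List.toFinset_cons,
        Finset.insert_idem]
      exact Finset.card_insert_of_notMem (by rwa [List.mem_toFinset])
    -- Replacing the full plane `p` by one vector from each of two planes missed by `l'` meets one
    -- more plane, so the induction hypothesis applies.
    have hcross : ∀ r s : Fin g, r ≠ s → r ∉ l'.map planeIndex → s ∉ l'.map planeIndex →
        extProd (Sum.inl r :: Sum.inr s :: l') ∈ U := by
      intro r s hrs hr hs
      have hr' : ∀ t ∈ l', planeIndex t ≠ r := fun t ht h' => hr (List.mem_map.mpr ⟨t, ht, h'⟩)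
      have hs' : ∀ t ∈ l', planeIndex t ≠ s := fun t ht h' => hs (List.mem_map.mpr ⟨t, ht, h'⟩)
      refine ih _ (by simpa using hlen) ?_ ?_
      · simp only [List.nodup_cons, List.mem_cons, reduceCtorEq, false_or] at hnd' ⊢
        exact ⟨fun h' => hr' _ h' rfl, fun h' => hs' _ h' rfl, hnd'.2.2⟩
      · rw [List.map_cons, List.map_cons, List.toFinset_cons, List.toFinset_cons,
          Finset.card_insert_of_notMem, Finset.card_insert_of_notMem]
        · omega
        · rwa [List.mem_toFinset]
        · rw [Finset.mem_insert, List.mem_toFinset]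
          rintro (h' | h')
          · exact hrs h'
          · exact hr h'
    have hdiff : ∀ q, q ∉ l'.map planeIndex →
        extProd (Sum.inl q :: Sum.inr q :: l') - extProd (Sum.inl p :: Sum.inr p :: l') ∈ U := by
      intro q hq
      by_cases hpq : p = q
      · subst hpq
        rw [sub_self]
        exact U.zero_mem
      have h1 := hU (rotation hpq) _ (hcross p q hpq hpl hq)
      rw [extAct_rotation_extProd hpq hpl hq] at h1
      have h2 := (Submodule.add_mem_iff_right _ (U.sub_mem
        (U.smul_mem (9 / 25 : ℂ) (hcross p q hpq hpl hq))
        (U.smul_mem (16 / 25 : ℂ) (hcross q p (Ne.symm hpq) hq hpl)))).mp h1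
      exact (Submodule.smul_mem_iff _ (by norm_num)).mp h2
    -- Modulo `U` all full planes missed by `l'` are equal by `hdiff`, and their sum is `ω` times
    -- `extProd l'`, which lies in `U`. Hence `F.card` times one of them lies in `U`, and `F`
    -- contains `p`.
    let F : Finset (Fin g) := Finset.univ.filter fun q => q ∉ l'.map planeIndex
    have hsum : extOmega g * extProd l' = ∑ q ∈ F, extProd (Sum.inl q :: Sum.inr q :: l') := by
      rw [extOmega_mul_extProd, Finset.sum_filter]
      refine Finset.sum_congr rfl fun q _ => ?_
      split_ifs with hq
      · refine extProd_eq_zero fun h' => ?_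
        obtain ⟨s, hs, rfl⟩ := List.mem_map.mp hq
        rcases s with s | s <;> simp [hs] at h'
      · rfl
    have h3 : (F.card : ℂ) • extProd (Sum.inl p :: Sum.inr p :: l') ∈ U := by
      have h4 := U.sub_mem (hω l' hlen)
        (U.sum_mem (t := F) fun q hq => hdiff q (Finset.mem_filter.mp hq).2)
      rwa [hsum, Finset.sum_sub_distrib, sub_sub_cancel, Finset.sum_const,
        ← Nat.cast_smul_eq_nsmul ℂ] at h4
    refine (Submodule.smul_mem_iff _ ?_).mp h3
    refine Nat.cast_ne_zero.mpr (Finset.card_ne_zero_of_mem (a := p) ?_)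
    simpa [F] using hpl

/-! ### The exterior powers -/

theorem coe_exteriorPowerRep (i : ℕ) (x : USp g) (y : ⋀[ℂ]^i (Fin g ⊕ Fin g → ℂ)) :
    (exteriorPowerRep g i x y : ExtAlg g) = extAct x y := by
  have h : (⋀[ℂ]^i (Fin g ⊕ Fin g → ℂ)).subtype ∘ₗ exteriorPowerRep g i x =
      (extAct x).toLinearMap ∘ₗ (⋀[ℂ]^i (Fin g ⊕ Fin g → ℂ)).subtype := by
    refine exteriorPower.linearMap_ext ?_
    ext v
    change (exteriorPower.map i (standardRep g x) (exteriorPower.ιMulti ℂ i v) : ExtAlg g) =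
      ExteriorAlgebra.map (standardRep g x) (ExteriorAlgebra.ιMulti ℂ i v)
    rw [exteriorPower.map_apply_ιMulti, ExteriorAlgebra.map_apply_ιMulti]
    rfl
  exact LinearMap.congr_fun h y

theorem span_extProd (i : ℕ) : Submodule.span ℂ {y | ∃ l : List (Fin g ⊕ Fin g),
    l.length = i ∧ extProd l = y} = ⋀[ℂ]^i (Fin g ⊕ Fin g → ℂ) := by
  have hs : Submodule.span ℂ (Set.range fun s : Fin g ⊕ Fin g => (Pi.single s (1 : ℂ) :
      Fin g ⊕ Fin g → ℂ)) = ⊤ := by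
    have := (Pi.basisFun ℂ (Fin g ⊕ Fin g)).span_eq
    rwa [funext (Pi.basisFun_apply ℂ (Fin g ⊕ Fin g))] at this
  rw [← exteriorPower.ιMulti_span_fixedDegree_of_span_eq_top ℂ i _ hs]
  congr 1
  ext y
  constructor
  · rintro ⟨l, rfl, rfl⟩
    refine ⟨fun k => Pi.single (l.get k) 1, ?_, ?_⟩
    · rintro - ⟨k, rfl⟩
      exact ⟨_, rfl⟩
    · rw [ExteriorAlgebra.ιMulti_apply, extProd]
      congr 1
      conv_rhs => rw [← List.ofFn_get l, List.map_ofFn]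
      rfl
  · rintro ⟨v, hv, rfl⟩
    choose s hs using fun k => hv (Set.mem_range_self k)
    refine ⟨List.ofFn s, List.length_ofFn, ?_⟩
    rw [ExteriorAlgebra.ιMulti_apply, extProd, List.map_ofFn]
    congr 2
    funext k
    rw [← hs]
    rfl

/-- On decomposable vectors the coefficients are polynomials in the matrix entries. -/
theorem continuous_exteriorPowerRep (i : ℕ) : (exteriorPowerRep g i).HasContinuousCoeffs := by
  intro y φ
  have hy : y ∈ Submodule.span ℂ (Set.range (exteriorPower.ιMulti ℂ (M := Fin g ⊕ Fin g → ℂ) i)) := by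
    rw [exteriorPower.ιMulti_span]
    trivial
  induction hy using Submodule.span_induction with
  | mem y h =>
    obtain ⟨v, rfl⟩ := h
    have h1 : ∀ x, φ (exteriorPowerRep g i x (exteriorPower.ιMulti ℂ i v)) =
        ∑ t : Fin i → Fin g ⊕ Fin g, (∏ k, (toMatrix x *ᵥ v k) (t k)) *
          φ (exteriorPower.ιMulti ℂ i fun k => Pi.single (t k) 1) := by
      intro x
      have h2 : exteriorPowerRep g i x (exteriorPower.ιMulti ℂ i v) =
          exteriorPower.ιMulti ℂ i fun k =>
            ∑ s, (toMatrix x *ᵥ v k) s • (Pi.single s 1 : Fin g ⊕ Fin g → ℂ) := by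
        refine (exteriorPower.map_apply_ιMulti _ _).trans (congrArg _ (funext fun k => ?_))
        exact pi_eq_sum_univ' _
      rw [h2, ← AlternatingMap.coe_multilinearMap, MultilinearMap.map_sum, map_sum]
      refine Finset.sum_congr rfl fun t _ => ?_
      rw [MultilinearMap.map_smul_univ, map_smul, smul_eq_mul]
    simp only [h1]
    refine continuous_finsetSum _ fun t _ => Continuous.mul ?_ continuous_const
    refine continuous_finsetProd _ fun k _ => ?_
    exact (continuous_apply (t k)).comp (continuous_toMatrix.matrix_mulVec continuous_const)
  | zero => simpa using continuous_const
  | add y z _ _ hy hz =>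
    simp only [map_add]
    exact hy.add hz
  | smul c y _ hy =>
    simp only [map_smul]
    exact hy.const_smul c

/-- The diagonal entries of an element of the torus. -/
def torusEntry (z : Fin g → Circle) : Fin g ⊕ Fin g → ℂ :=
  Sum.elim (fun k => (z k : ℂ)) fun k => ((z k)⁻¹ : Circle)

theorem character_exteriorPowerRep_torus (i : ℕ) (z : Fin g → Circle) :
    (exteriorPowerRep g i).character (torus z) =
      ∑ S ∈ Finset.powersetCard i Finset.univ, ∏ s ∈ S, torusEntry z s := by
  -- An auxiliary order, used only to form the basis of the exterior power; the torus is diagonal in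
  -- that basis.
  let _ : LinearOrder (Fin g ⊕ Fin g) := LinearOrder.lift' finSumFinEquiv finSumFinEquiv.injective
  let b := (Pi.basisFun ℂ (Fin g ⊕ Fin g)).exteriorPower i
  have hb : ∀ S, exteriorPowerRep g i (torus z) (b S) =
      (∏ s ∈ S.1, torusEntry z s) • b S := by
    intro S
    have hf : ⇑(standardRep g (torus z)) ∘ ⇑(Pi.basisFun ℂ (Fin g ⊕ Fin g)) =
        fun s => torusEntry z s • Pi.basisFun ℂ (Fin g ⊕ Fin g) s := by
      funext s
      rw [Function.comp_apply, Pi.basisFun_apply, standardRep_single, toMatrix_torus]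
      funext t
      simp [diagonal_apply, Pi.single_apply, torusEntry]
      split_ifs with h
      · rw [h]
      · rfl
    rw [exteriorPower.coe_basis]
    refine (exteriorPower.map_apply_ιMulti_family _ _ _).trans ?_
    rw [hf, exteriorPower.ιMulti_family, ← AlternatingMap.coe_multilinearMap]
    refine (MultilinearMap.map_smul_univ _ _ _).trans ?_
    congr 1
    conv_rhs => rw [← Finset.map_orderEmbOfFin_univ S.1 S.2, Finset.prod_map]
    rfl
  rw [Representation.character, LinearMap.trace_eq_matrix_trace ℂ b, trace]
  simp only [diag_apply, LinearMap.toMatrix_apply, hb, map_smul, Finsupp.smul_apply,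
    Basis.repr_self, Finsupp.single_eq_same, smul_eq_mul, mul_one]
  rw [Finset.sum_subtype _ (p := fun S => S ∈ Set.powersetCard (Fin g ⊕ Fin g) i)]
  simp [Finset.mem_powersetCard, Set.powersetCard.mem_iff]

theorem a_torus {i : ℕ} (hi : i ≤ 2 * g) (z : Fin g → Circle) :
    a g i (torus z) = ∑ S ∈ Finset.powersetCard i Finset.univ, ∏ s ∈ S, torusEntry z s := by
  have hcard : (Finset.univ.val.map (torusEntry z)).card = 2 * g := by
    simp
    omega
  have h1 : (toMatrix (torus z)).charpoly =
      ((Finset.univ.val.map (torusEntry z)).map fun t => Polynomial.X - Polynomial.C t).prod := by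
    rw [toMatrix_torus, charpoly_diagonal, Multiset.map_map]
    rfl
  rw [a, h1, Multiset.prod_X_sub_C_coeff _ (by omega), hcard, Nat.sub_sub_self hi,
    Finset.esymm_map_val, ← mul_assoc, ← mul_pow]
  simp

theorem a_conj (i : ℕ) (x y : USp g) : a g i (y * x * y⁻¹) = a g i x := by
  rw [a, a, toMatrix_mul, charpoly_mul_comm, ← toMatrix_mul, inv_mul_cancel_left]

/-- Two class functions that agree on the torus are equal, since every element is conjugate into it.
-/
theorem a_eq_character {i : ℕ} (hi : i ≤ 2 * g) : a g i = (exteriorPowerRep g i).character := by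
  funext x
  obtain ⟨y, z, rfl⟩ := exists_eq_conj_torus x
  rw [Representation.char_conj, character_exteriorPowerRep_torus, ← a_torus hi, a_conj]

end USp

end

/-! ### Weight multiplicities, Weyl symmetry and dominance -/

noncomputable section

open Module Matrix

namespace USp

variable {g : ℕ}

/-! ### Restriction to the torus -/

section Restriction

variable {V : Type*} [AddCommGroup V] [Module ℂ V]

/-- The restriction of a representation to the standard torus. -/
def restrictTorus (ρ : Representation ℂ (USp g) V) : Representation ℂ (Fin g → Circle) V :=
  ρ.comp (torusHom g)

theorem restrictTorus_apply (ρ : Representation ℂ (USp g) V) (z : Fin g → Circle) :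
    restrictTorus ρ z = ρ (torus z) := rfl

theorem continuous_restrictTorus {ρ : Representation ℂ (USp g) V} (h : ρ.HasContinuousCoeffs) :
    (restrictTorus ρ).HasContinuousCoeffs :=
  h.comp continuous_torusHom

theorem isWeight_iff_ne_bot (ρ : Representation ℂ (USp g) V) (μ : Weight g) :
    IsWeight ρ μ ↔ torusWeightSpace (restrictTorus ρ) μ ≠ ⊥ := by
  rw [Submodule.ne_bot_iff]
  exact ⟨fun ⟨v, h0, h⟩ => ⟨v, h, h0⟩, fun ⟨v, h, h0⟩ => ⟨v, h0, h⟩⟩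

variable [FiniteDimensional ℂ V]

theorem isWeight_iff_formalCharacter (ρ : Representation ℂ (USp g) V) (μ : Weight g) :
    IsWeight ρ μ ↔ formalCharacter (restrictTorus ρ) μ ≠ 0 := by
  rw [isWeight_iff_ne_bot, formalCharacter_apply, Nat.cast_ne_zero, Ne, Ne,
    Submodule.finrank_eq_zero]

theorem character_torus {ρ : Representation ℂ (USp g) V} (h : ρ.HasContinuousCoeffs)
    (z : Fin g → Circle) :
    ρ.character (torus z) = trigPoly (formalCharacter (restrictTorus ρ)) z :=
  congrFun (character_eq_trigPoly (continuous_restrictTorus h)) z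

end Restriction

/-! ### Invariance under the Weyl group -/

/-- Change the sign of the coordinates in `P`. -/
def flipWeight (P : Finset (Fin g)) (μ : Weight g) : Weight g :=
  fun k => if k ∈ P then -μ k else μ k

/-- Invariance under signed permutations of the coordinates. -/
structure WeylInvariant (m : Weight g →₀ ℂ) : Prop where
  perm : ∀ (σ : Equiv.Perm (Fin g)) (μ : Weight g), m (μ ∘ σ) = m μ
  flip : ∀ (P : Finset (Fin g)) (μ : Weight g), m (flipWeight P μ) = m μ

theorem flipWeight_flipWeight (P : Finset (Fin g)) (μ : Weight g) :
    flipWeight P (flipWeight P μ) = μ := by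
  funext k
  by_cases h : k ∈ P <;> simp [flipWeight, h]

/-- Uniqueness of Fourier coefficients turns a symmetry of the function on the torus into a symmetry
of its coefficients. -/
theorem apply_eq_of_trigPoly_eq {m : Weight g →₀ ℂ} {f : Weight g → Weight g}
    (hf : Function.Injective f) {w : (Fin g → Circle) → (Fin g → Circle)}
    (hfw : ∀ μ z, torusMonomial (f μ) z = torusMonomial μ (w z))
    (h : ∀ z, trigPoly m (w z) = trigPoly m z) (μ : Weight g) : m (f μ) = m μ := by
  have h1 : m.mapDomain f = m := by
    refine trigPoly_injective (funext fun z => ?_)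
    rw [← h z, trigPoly, trigPoly,
      Finsupp.sum_mapDomain_index (fun _ => zero_mul _) (fun _ _ _ => add_mul _ _ _)]
    simp only [hfw]
  conv_lhs => rw [← h1]
  exact Finsupp.mapDomain_apply hf m μ

theorem WeylInvariant.of_classFunction {m : Weight g →₀ ℂ} {χ : USp g → ℂ}
    (hχ : ∀ x y, χ (y * x * y⁻¹) = χ x) (h : ∀ z, χ (torus z) = trigPoly m z) :
    WeylInvariant m where
  perm σ := by
    refine apply_eq_of_trigPoly_eq (w := fun z => z ∘ σ.symm)
      (fun μ ν hμν => ?_) (fun μ z => ?_) fun z => ?_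
    · funext k
      simpa using congrFun hμν (σ.symm k)
    · rw [torusMonomial_apply, torusMonomial_apply]
      exact Fintype.prod_equiv σ _ _ fun k => by simp
    · rw [← h, ← h, ← hχ _ (ofPerm σ.symm), ofPerm_mul_torus, mul_inv_cancel_right]
  flip P := by
    refine apply_eq_of_trigPoly_eq (w := fun z k => if k ∈ P then (z k)⁻¹ else z k)
      (fun μ ν hμν => ?_) (fun μ z => ?_) fun z => ?_
    · rw [← flipWeight_flipWeight P μ, hμν, flipWeight_flipWeight]
    · rw [torusMonomial_apply, torusMonomial_apply]
      refine Finset.prod_congr rfl fun k _ => ?_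
      by_cases hk : k ∈ P <;> simp [flipWeight, hk]
    · rw [← h, ← h, ← hχ _ (signFlip P), signFlip_mul_torus, mul_inv_cancel_right]

theorem WeylInvariant.abs {m : Weight g →₀ ℂ} (h : WeylInvariant m) (μ : Weight g) :
    m (fun k => |μ k|) = m μ := by
  rw [← h.flip (Finset.univ.filter fun k => μ k < 0) μ]
  congr 1
  funext k
  by_cases hk : μ k < 0
  · simp [flipWeight, hk, abs_of_neg hk]
  · simp [flipWeight, hk, abs_of_nonneg (not_lt.mp hk)]

theorem WeylInvariant.sub_smul {m n : Weight g →₀ ℂ} (hm : WeylInvariant m)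
    (hn : WeylInvariant n) (c : ℂ) : WeylInvariant (m - c • n) where
  perm σ μ := by simp [hm.perm, hn.perm]
  flip P μ := by simp [hm.flip, hn.flip]

/-! ### The weights of the exterior powers -/

/-- The signed permutations of `ϖ_i, ϖ_{i-2}, …`. -/
def IsSmallWeight (i : ℕ) (μ : Weight g) : Prop :=
  (∀ p, |μ p| ≤ 1) ∧ ∃ k : ℕ, ∑ p, |μ p| + 2 * k = i

theorem sum_fundamentalWeight {i : ℕ} (hi : i ≤ g) :
    ∑ p, fundamentalWeight g i p = i := by
  simp only [fundamentalWeight, Finset.sum_ite, Finset.sum_const_zero, add_zero, Finset.sum_const,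
    nsmul_eq_mul, mul_one, Nat.cast_inj]
  rw [Fin.card_filter_val_lt, min_eq_right hi]

theorem abs_fundamentalWeight (i : ℕ) (p : Fin g) :
    |fundamentalWeight g i p| = fundamentalWeight g i p := by
  rw [fundamentalWeight]
  split_ifs <;> simp

/-- This separates the candidates: `ϖ_i` cannot be a weight of `Λ^j` for `j < i`. -/
theorem fundamentalWeight_injOn {i j : ℕ} (hi : i ≤ g)
    (h : IsSmallWeight (g := g) j (fundamentalWeight g i)) : i ≤ j := by
  obtain ⟨-, k, hk⟩ := h
  simp only [abs_fundamentalWeight, sum_fundamentalWeight hi] at hk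
  omega

/-- The weight of the product of the basis vectors in `S`. -/
def setWeight (S : Finset (Fin g ⊕ Fin g)) : Weight g := fun p =>
  (if Sum.inl p ∈ S then 1 else 0) - if Sum.inr p ∈ S then 1 else 0

variable (g) in
/-- The formal character of the `i`-th exterior power of the standard representation. -/
def extCoeff (i : ℕ) : Weight g →₀ ℂ :=
  ∑ S ∈ Finset.powersetCard i Finset.univ, Finsupp.single (setWeight S) 1

theorem prod_torusEntry (S : Finset (Fin g ⊕ Fin g)) (z : Fin g → Circle) :
    ∏ s ∈ S, torusEntry z s = torusMonomial (setWeight S) z := by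
  have h1 : ∏ s ∈ S, torusEntry z s = ∏ s, if s ∈ S then torusEntry z s else 1 := by simp
  rw [h1, Fintype.prod_sum_type, ← Finset.prod_mul_distrib, torusMonomial_apply]
  refine Finset.prod_congr rfl fun p _ => ?_
  by_cases hl : Sum.inl p ∈ S <;> by_cases hr : Sum.inr p ∈ S <;>
    simp [setWeight, hl, hr, torusEntry]

theorem trigPoly_extCoeff (i : ℕ) (z : Fin g → Circle) :
    trigPoly (extCoeff g i) z =
      ∑ S ∈ Finset.powersetCard i Finset.univ, ∏ s ∈ S, torusEntry z s := by
  rw [trigPoly, extCoeff, ← Finsupp.sum_finsetSum_index (fun _ => zero_mul _)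
    (fun _ _ _ => add_mul _ _ _)]
  refine Finset.sum_congr rfl fun S _ => ?_
  rw [Finsupp.sum_single_index (zero_mul _), one_mul, prod_torusEntry]

theorem extCoeff_apply (i : ℕ) (μ : Weight g) :
    extCoeff g i μ = ((Finset.powersetCard i Finset.univ).filter fun S => setWeight S = μ).card := by
  simp [extCoeff, Finsupp.finsetSum_apply, Finsupp.single_apply]

theorem isSmallWeight_setWeight (S : Finset (Fin g ⊕ Fin g)) :
    IsSmallWeight S.card (setWeight S) := by
  have h1 : (S.card : ℤ) = ∑ p : Fin g, ((if Sum.inl p ∈ S then 1 else 0) +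
      if Sum.inr p ∈ S then 1 else 0) := by
    rw [Finset.sum_add_distrib, ← Fintype.sum_sum_type (fun s => if s ∈ S then (1 : ℤ) else 0)]
    simp
  -- The witness counts the planes contained in `S`: each adds two elements and no weight.
  refine ⟨fun p => ?_, (Finset.univ.filter fun p => Sum.inl p ∈ S ∧ Sum.inr p ∈ S).card, ?_⟩
  · rw [setWeight]
    split_ifs <;> simp
  · rw [h1, Finset.card_filter]
    push_cast
    rw [Finset.mul_sum, ← Finset.sum_add_distrib]
    refine Finset.sum_congr rfl fun p _ => ?_
    by_cases hl : Sum.inl p ∈ S <;> by_cases hr : Sum.inr p ∈ S <;> simp [setWeight, hl, hr]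

theorem isSmallWeight_of_extCoeff_ne_zero {i : ℕ} {μ : Weight g} (h : extCoeff g i μ ≠ 0) :
    IsSmallWeight i μ := by
  rw [extCoeff_apply, Nat.cast_ne_zero, Finset.card_ne_zero] at h
  obtain ⟨S, hS⟩ := h
  rw [Finset.mem_filter, Finset.mem_powersetCard] at hS
  rw [← hS.2, ← hS.1.2]
  exact isSmallWeight_setWeight S

/-- A set of weight `ϖ_i` must contain the first `i` positive vectors, and its cardinality leaves no
room for more. -/
theorem extCoeff_fundamentalWeight {i : ℕ} (hi : i ≤ g) :
    extCoeff g i (fundamentalWeight g i) = 1 := by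
  rw [extCoeff_apply, Nat.cast_eq_one, Finset.card_eq_one]
  refine ⟨(Finset.univ.filter fun p : Fin g => p.val < i).map ⟨Sum.inl, Sum.inl_injective⟩, ?_⟩
  ext S
  simp only [Finset.mem_filter, Finset.mem_powersetCard, Finset.subset_univ, true_and,
    Finset.mem_singleton]
  constructor
  · rintro ⟨hc, hS⟩
    symm
    refine Finset.eq_of_subset_of_card_le (fun s hs => ?_) ?_
    · obtain ⟨p, hp, rfl⟩ := Finset.mem_map.mp hs
      have h1 := congrFun hS p
      simp only [Finset.mem_filter, Finset.mem_univ, true_and] at hp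
      rw [setWeight, fundamentalWeight, if_pos hp] at h1
      change Sum.inl p ∈ S
      by_contra hn
      rw [if_neg hn] at h1
      split_ifs at h1 <;> omega
    · rw [hc, Finset.card_map, Fin.card_filter_val_lt, min_eq_right hi]
  · rintro rfl
    refine ⟨by rw [Finset.card_map, Fin.card_filter_val_lt, min_eq_right hi], ?_⟩
    funext p
    simp [setWeight, fundamentalWeight]

theorem weylInvariant_extCoeff {i : ℕ} (hi : i ≤ 2 * g) : WeylInvariant (extCoeff g i) :=
  WeylInvariant.of_classFunction (χ := a g i) (fun x y => a_conj i x y) fun z => by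
    rw [a_torus hi, trigPoly_extCoeff]

/-! ### Dominance -/

theorem sum_simpleRoot_apply_zero (hg : 0 < g) (c : Fin g → ℕ) :
    0 ≤ (∑ k, c k • simpleRoot k) ⟨0, hg⟩ := by
  rw [Finset.sum_apply]
  refine Finset.sum_nonneg fun k _ => ?_
  rw [Pi.smul_apply]
  refine nsmul_nonneg ?_ _
  rw [simpleRoot]
  split_ifs with h1 h2 h3
  · norm_num
  · norm_num
  · simp at h3
  · norm_num

theorem sum_simpleRoot (k : Fin g) :
    ∑ j, simpleRoot k j = if k.val + 1 = g then 2 else 0 := by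
  have key : ∀ j : Fin g, simpleRoot k j =
      (if j = k then (if k.val + 1 = g then 2 else 1) else 0) +
      if j.val = k.val + 1 then -1 else 0 := by
    intro j
    simp only [simpleRoot, Fin.ext_iff]
    split_ifs <;> omega
  simp only [key, Finset.sum_add_distrib, Finset.sum_ite_eq', Finset.mem_univ, if_true]
  by_cases hk : k.val + 1 = g
  · rw [if_pos hk, if_pos hk, Finset.sum_eq_zero, add_zero]
    exact fun j _ => if_neg (by omega)
  · rw [if_neg hk, if_neg hk, Finset.sum_eq_single (⟨k.val + 1, by omega⟩ : Fin g)]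
    · simp
    · intro j _ hj
      exact if_neg fun h => hj (Fin.ext h)
    · simp

/-- Only the long root `2 e_g` has nonzero coordinate sum, namely `2`. -/
theorem exists_sum_eq_of_dominanceLE {μ lam : Weight g} (h : DominanceLE μ lam) :
    ∃ k : ℕ, ∑ p, μ p + 2 * k = ∑ p, lam p := by
  obtain ⟨c, hc⟩ := h
  refine ⟨∑ k : Fin g, if k.val + 1 = g then c k else 0, ?_⟩
  have h1 : ∑ p, (lam - μ) p = ∑ k : Fin g, 2 * (if k.val + 1 = g then (c k : ℤ) else 0) := by
    rw [hc]
    simp only [Finset.sum_apply, Pi.smul_apply]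
    rw [Finset.sum_comm]
    refine Finset.sum_congr rfl fun k _ => ?_
    rw [← Finset.smul_sum, sum_simpleRoot]
    split_ifs <;> simp [mul_comm]
  simp only [Pi.sub_apply, Finset.sum_sub_distrib] at h1
  push_cast
  rw [Finset.mul_sum, ← h1]
  ring

/-- By symmetry any `|μ p|` can be moved to the first coordinate, which never exceeds that of `ϖ_i`
because no simple root is negative there. The same domination, applied to the absolute values,
controls their sum and its parity. -/
theorem WeylInvariant.isSmallWeight {m : Weight g →₀ ℂ} (h : WeylInvariant m) {i : ℕ} (hi : i ≤ g)
    (hm : ∀ μ, m μ ≠ 0 → DominanceLE μ (fundamentalWeight g i)) {μ : Weight g} (hμ : m μ ≠ 0) :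
    IsSmallWeight i μ := by
  constructor
  · intro p
    have hg : 0 < g := p.pos
    have h1 : m ((fun k => |μ k|) ∘ Equiv.swap ⟨0, hg⟩ p) ≠ 0 := by
      rw [h.perm, h.abs]
      exact hμ
    obtain ⟨c, hc⟩ := hm _ h1
    have h2 := sum_simpleRoot_apply_zero hg c
    rw [← hc] at h2
    simp only [Pi.sub_apply, Function.comp_apply, Equiv.swap_apply_left, fundamentalWeight] at h2
    split_ifs at h2 <;> omega
  · obtain ⟨k, hk⟩ := exists_sum_eq_of_dominanceLE (hm _ (by rwa [h.abs] : m (fun k => |μ k|) ≠ 0))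
    exact ⟨k, by rw [hk, sum_fundamentalWeight hi]⟩

theorem exists_perm_abs_eq {i : ℕ} (hi : i ≤ g) {μ : Weight g} (h1 : ∀ p, |μ p| ≤ 1)
    (h2 : ∑ p, |μ p| = i) :
    ∃ σ : Equiv.Perm (Fin g), (fun p => |μ p|) ∘ σ = fundamentalWeight g i := by
  have h3 : ∀ p, |μ p| = if μ p ≠ 0 then 1 else 0 := by
    intro p
    have := h1 p
    split_ifs with h0
    · have := abs_pos.mpr h0
      omega
    · simpa using h0
  have hcard : Fintype.card {p : Fin g // p.val < i} = Fintype.card {p // μ p ≠ 0} := by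
    have h4 : ((Finset.univ.filter fun p => μ p ≠ 0).card : ℤ) = i := by
      rw [← h2, Finset.card_filter]
      push_cast
      exact Finset.sum_congr rfl fun p _ => (h3 p).symm
    rw [Fintype.card_subtype, Fintype.card_subtype, Fin.card_filter_val_lt, min_eq_right hi]
    exact_mod_cast h4.symm
  let e := Fintype.equivOfCardEq hcard
  refine ⟨e.extendSubtype, funext fun p => ?_⟩
  rw [Function.comp_apply, h3, fundamentalWeight]
  by_cases hp : p.val < i
  · rw [if_pos hp, if_pos (e.extendSubtype_mem p hp)]
  · rw [if_neg hp, if_neg (e.extendSubtype_not_mem p hp)]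

/-- Subtracting the multiple of `Λ^i` that matches `m` at `ϖ_i` kills the whole orbit of `ϖ_i`; what
remains is supported one level lower, at `i - 2`, or is zero if `i < 2`. -/
theorem WeylInvariant.exists_eq_sum_extCoeff (i : ℕ) : ∀ (m : Weight g →₀ ℂ), i ≤ g →
    WeylInvariant m → (∀ μ, m μ ≠ 0 → IsSmallWeight i μ) →
    ∃ n : ℕ → ℂ, m = ∑ j ∈ Finset.range (i + 1), n j • extCoeff g j := by
  induction i using Nat.strong_induction_on with
  | _ i ih =>
    intro m hi hm hsupp
    let m' := m - m (fundamentalWeight g i) • extCoeff g i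
    have hm' : WeylInvariant m' := hm.sub_smul (weylInvariant_extCoeff (by omega)) _
    have h0 : m' (fundamentalWeight g i) = 0 := by
      simp [m', extCoeff_fundamentalWeight hi]
    have hs' : ∀ μ, m' μ ≠ 0 → (∀ p, |μ p| ≤ 1) ∧ ∃ k : ℕ, ∑ p, |μ p| + 2 * (k + 1) = (i : ℤ) := by
      intro μ hμ
      have h1 : IsSmallWeight i μ := by
        by_contra hn
        have e1 : m μ = 0 := by
          by_contra h
          exact hn (hsupp μ h)
        have e2 : extCoeff g i μ = 0 := by
          by_contra h
          exact hn (isSmallWeight_of_extCoeff_ne_zero h)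
        exact hμ (by simp [m', e1, e2])
      obtain ⟨h2, k, hk⟩ := h1
      refine ⟨h2, ?_⟩
      rcases k with - | k
      · obtain ⟨σ, hσ⟩ := exists_perm_abs_eq hi h2 (by simpa using hk)
        rw [← hm'.abs, ← hm'.perm σ, hσ] at hμ
        exact absurd h0 hμ
      · exact ⟨k, by rw [← hk]; push_cast; ring⟩
    have hdecomp : m = m' + m (fundamentalWeight g i) • extCoeff g i := by simp [m']
    by_cases hi2 : 2 ≤ i
    · obtain ⟨n, hn⟩ := ih (i - 2) (by omega) m' (by omega) hm' fun μ hμ => by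
        obtain ⟨h1, k, hk⟩ := hs' μ hμ
        exact ⟨h1, k, by push_cast [Nat.cast_sub hi2]; linarith⟩
      refine ⟨fun j => (if j < i - 2 + 1 then n j else 0) +
        if j = i then m (fundamentalWeight g i) else 0, ?_⟩
      conv_lhs => rw [hdecomp, hn]
      simp only [add_smul, Finset.sum_add_distrib, ite_smul, zero_smul]
      congr 1
      · rw [← Finset.sum_filter]
        refine Finset.sum_congr ?_ fun _ _ => rfl
        ext j
        simp only [Finset.mem_range, Finset.mem_filter]
        omega
      · simp
    · have hz : m' = 0 := by
        ext μ
        by_contra hμ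
        obtain ⟨-, k, hk⟩ := hs' μ hμ
        have : 0 ≤ ∑ p, |μ p| := Finset.sum_nonneg fun p _ => abs_nonneg _
        omega
      refine ⟨fun j => if j = i then m (fundamentalWeight g i) else 0, ?_⟩
      conv_lhs => rw [hdecomp, hz, zero_add]
      simp

theorem sum_nsmul_simpleRoot_apply (c : Fin g → ℕ) (j : Fin g) :
    (∑ k, c k • simpleRoot k) j = c j * (if j.val + 1 = g then 2 else 1) -
      ∑ k : Fin g, if j.val = k.val + 1 then (c k : ℤ) else 0 := by
  have key : ∀ k : Fin g, (c k • simpleRoot k) j =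
      (if j = k then (c k : ℤ) * (if k.val + 1 = g then 2 else 1) else 0) -
      if j.val = k.val + 1 then (c k : ℤ) else 0 := by
    intro k
    simp only [Pi.smul_apply, simpleRoot, Fin.ext_iff, nsmul_eq_mul]
    split_ifs <;> omega
  rw [Finset.sum_apply]
  simp only [key, Finset.sum_sub_distrib, Finset.sum_ite_eq, Finset.mem_univ, if_true]

theorem IsSmallWeight.dominanceLE {i : ℕ} (hi : i ≤ g) {μ : Weight g} (h : IsSmallWeight i μ) :
    DominanceLE μ (fundamentalWeight g i) := by
  obtain ⟨h1, K, hK⟩ := h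
  -- The coefficient of `e_k - e_{k+1}` is the partial sum `D k`. For the last root `2 e_g` it is
  -- half the total, which is `K + N`, with `N` the number of negative coordinates of `μ`.
  let D : Fin g → ℤ := fun k => ∑ p ∈ Finset.Iic k, (fundamentalWeight g i p - μ p)
  let N : ℕ := (Finset.univ.filter fun p => μ p < 0).card
  have hDnonneg : ∀ k, 0 ≤ D k := by
    intro k
    have e1 : ∑ p ∈ Finset.Iic k, μ p ≤ ∑ p ∈ Finset.Iic k, |μ p| :=
      Finset.sum_le_sum fun p _ => le_abs_self _
    simp only [D, Finset.sum_sub_distrib, sub_nonneg]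
    refine e1.trans ?_
    by_cases hk : k.val < i
    · refine Finset.sum_le_sum fun p hp => ?_
      have : p.val < i := lt_of_le_of_lt (Fin.le_def.mp (Finset.mem_Iic.mp hp)) hk
      rw [fundamentalWeight, if_pos this]
      exact h1 p
    · have e2 : ∑ p ∈ Finset.Iic k, fundamentalWeight g i p = i := by
        rw [← sum_fundamentalWeight hi]
        refine Finset.sum_subset (Finset.subset_univ _) fun p _ hp => ?_
        rw [Finset.mem_Iic, not_le, Fin.lt_def] at hp
        rw [fundamentalWeight, if_neg (by omega)]
      rw [e2]
      have e3 : ∑ p ∈ Finset.Iic k, |μ p| ≤ ∑ p, |μ p| :=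
        Finset.sum_le_sum_of_subset_of_nonneg (Finset.subset_univ _) fun p _ _ => abs_nonneg _
      omega
  have hDlast : ∀ k : Fin g, k.val + 1 = g → D k = 2 * ((K + N : ℕ) : ℤ) := by
    intro k hk
    have e1 : Finset.Iic k = Finset.univ := by
      ext p
      simp only [Finset.mem_Iic, Finset.mem_univ, iff_true, Fin.le_def]
      omega
    have e2 : ∑ p, |μ p| = ∑ p, μ p + 2 * (N : ℤ) := by
      simp only [N, Finset.card_filter]
      push_cast
      rw [Finset.mul_sum, ← Finset.sum_add_distrib]
      refine Finset.sum_congr rfl fun p _ => ?_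
      have := h1 p
      split_ifs with h0
      · rw [abs_of_neg h0] at this ⊢
        omega
      · rw [abs_of_nonneg (not_lt.mp h0)]
        ring
    simp only [D, e1, Finset.sum_sub_distrib, sum_fundamentalWeight hi]
    push_cast
    linarith
  refine ⟨fun k => if k.val + 1 = g then K + N else (D k).toNat, ?_⟩
  funext j
  rw [sum_nsmul_simpleRoot_apply]
  have hj : (((if j.val + 1 = g then K + N else (D j).toNat : ℕ) : ℤ) *
      if j.val + 1 = g then 2 else 1) = D j := by
    split_ifs with h0
    · rw [hDlast j h0, mul_comm]
    · rw [Int.toNat_of_nonneg (hDnonneg j), mul_one]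
  rw [hj]
  have hprev : D j = fundamentalWeight g i j - μ j + ∑ k : Fin g, if j.val = k.val + 1 then
      (((if k.val + 1 = g then K + N else (D k).toNat : ℕ) : ℤ)) else 0 := by
    have e1 : D j = fundamentalWeight g i j - μ j +
        ∑ p ∈ Finset.Iio j, (fundamentalWeight g i p - μ p) := by
      simp only [D]
      rw [← Finset.Iio_insert, Finset.sum_insert (by simp)]
    rw [e1]
    congr 1
    by_cases h0 : j.val = 0
    · have : Finset.Iio j = ∅ := by
        ext p
        simp [Fin.lt_def, h0]
      rw [this, Finset.sum_empty, Finset.sum_eq_zero]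
      exact fun k _ => if_neg (by omega)
    · let j' : Fin g := ⟨j.val - 1, by omega⟩
      have hj' : j'.val + 1 = j.val := by simp only [j']; omega
      symm
      rw [Finset.sum_eq_single j']
      · rw [if_pos hj'.symm, if_neg (by omega), Int.toNat_of_nonneg (hDnonneg j')]
        refine Finset.sum_congr ?_ fun _ _ => rfl
        ext p
        simp only [Finset.mem_Iio, Finset.mem_Iic, Fin.lt_def, Fin.le_def]
        omega
      · intro k _ hk
        exact if_neg fun h => hk (Fin.ext (by omega))
      · simp
  rw [hprev]
  simp

end USp

end

/-! ### Existence and uniqueness of the fundamental characters -/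

noncomputable section

open Module Matrix

namespace USp

variable {g : ℕ}

/-! ### The virtual characters `a_i - a_{i-2}` -/

variable (g) in
/-- The function `a_i - a_{i-2}`, where `a_{-1} = a_{-2} = 0`. -/
def fundChar (i : ℕ) : USp g → ℂ := a g i - if 2 ≤ i then a g (i - 2) else 0

variable (g) in
/-- The formal character of `a_i - a_{i-2}`. -/
def fundCoeff (i : ℕ) : Weight g →₀ ℂ := extCoeff g i - if 2 ≤ i then extCoeff g (i - 2) else 0

theorem fundChar_torus {i : ℕ} (hi : i ≤ g) (z : Fin g → Circle) :
    fundChar g i (torus z) = trigPoly (fundCoeff g i) z := by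
  rw [fundChar, fundCoeff, trigPoly_sub, Pi.sub_apply, a_torus (by omega), trigPoly_extCoeff]
  congr 1
  split_ifs
  · rw [a_torus (by omega), trigPoly_extCoeff]
  · rfl

theorem fundCoeff_fundamentalWeight {i : ℕ} (hi : i ≤ g) :
    fundCoeff g i (fundamentalWeight g i) = 1 := by
  rw [fundCoeff, Finsupp.sub_apply, extCoeff_fundamentalWeight hi, sub_eq_self]
  split_ifs with h
  · by_contra hn
    have := fundamentalWeight_injOn hi (isSmallWeight_of_extCoeff_ne_zero hn)
    omega
  · rfl

theorem isSmallWeight_of_fundCoeff_ne_zero {i : ℕ} {μ : Weight g} (h : fundCoeff g i μ ≠ 0) :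
    IsSmallWeight i μ := by
  by_cases h1 : extCoeff g i μ = 0
  · rw [fundCoeff, Finsupp.sub_apply, h1, zero_sub, neg_ne_zero] at h
    split_ifs at h with hi
    · obtain ⟨h2, k, hk⟩ := isSmallWeight_of_extCoeff_ne_zero h
      exact ⟨h2, k + 1, by push_cast [Nat.cast_sub hi] at hk ⊢; linarith⟩
    · exact absurd rfl h
  · exact isSmallWeight_of_extCoeff_ne_zero h1

theorem continuous_a {i : ℕ} (hi : i ≤ 2 * g) : Continuous (a g i) := by
  rw [a_eq_character hi]
  exact (continuous_exteriorPowerRep i).continuous_character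

theorem formalCharacter_eq_fundCoeff {V : Type*} [AddCommGroup V] [Module ℂ V]
    [FiniteDimensional ℂ V] {ρ : Representation ℂ (USp g) V} (h : ρ.HasContinuousCoeffs)
    {i : ℕ} (hi : i ≤ g) (hρ : ρ.character = fundChar g i) :
    formalCharacter (restrictTorus ρ) = fundCoeff g i :=
  trigPoly_injective (funext fun z => by rw [← character_torus h, hρ, fundChar_torus hi])

theorem finrank_torusWeightSpace_fundamentalWeight {V : Type*} [AddCommGroup V] [Module ℂ V]
    [FiniteDimensional ℂ V] {ρ : Representation ℂ (USp g) V} (h : ρ.HasContinuousCoeffs)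
    {i : ℕ} (hi : i ≤ g) (hρ : ρ.character = fundChar g i) :
    finrank ℂ (torusWeightSpace (restrictTorus ρ) (fundamentalWeight g i)) = 1 := by
  rw [← Nat.cast_inj (R := ℂ), ← formalCharacter_apply, formalCharacter_eq_fundCoeff h hi hρ,
    fundCoeff_fundamentalWeight hi, Nat.cast_one]

theorem isIrreducibleCharacter_of_isIrreducible {V : Type} [AddCommGroup V] [Module ℂ V]
    [FiniteDimensional ℂ V] {ρ : Representation ℂ (USp g) V} {i : ℕ} (hi : i ≤ g)
    (h : ρ.HasContinuousCoeffs) (hirr : ρ.IsIrreducible) (hρ : ρ.character = fundChar g i) :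
    IsIrreducibleCharacter g (fundamentalWeight g i) (fundChar g i) := by
  have hform := formalCharacter_eq_fundCoeff h hi hρ
  refine ⟨V, _, _, ρ, ⟨inferInstance, h, hirr, ?_, fun μ hμ => ?_⟩, hρ⟩
  · rw [isWeight_iff_formalCharacter, hform, fundCoeff_fundamentalWeight hi]
    exact one_ne_zero
  · rw [isWeight_iff_formalCharacter, hform] at hμ
    exact (isSmallWeight_of_fundCoeff_ne_zero hμ).dominanceLE hi

/-! ### Multiplication by the invariant two-form -/

theorem extOmega_mul_mem {d : ℕ} {y : ExtAlg g} (hy : y ∈ ⋀[ℂ]^d (Fin g ⊕ Fin g → ℂ)) :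
    extOmega g * y ∈ ⋀[ℂ]^(d + 2) (Fin g ⊕ Fin g → ℂ) := by
  have h : extOmega g ∈ ⋀[ℂ]^2 (Fin g ⊕ Fin g → ℂ) := by
    refine Submodule.sum_mem _ fun p _ => ?_
    change _ ∈ LinearMap.range (ExteriorAlgebra.ι ℂ) ^ 2
    rw [pow_two]
    exact Submodule.mul_mem_mul (LinearMap.mem_range_self _ _) (LinearMap.mem_range_self _ _)
  change _ ∈ LinearMap.range (ExteriorAlgebra.ι ℂ) ^ (d + 2)
  rw [add_comm, pow_add]
  exact Submodule.mul_mem_mul h hy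

variable (g) in
/-- Multiplication by the invariant two-form, from `Λ^d` to `Λ^(d+2)`. -/
def extOmegaMul (d : ℕ) :
    ⋀[ℂ]^d (Fin g ⊕ Fin g → ℂ) →ₗ[ℂ] ⋀[ℂ]^(d + 2) (Fin g ⊕ Fin g → ℂ) :=
  LinearMap.restrict (LinearMap.mulLeft ℂ (extOmega g)) fun _ hy => extOmega_mul_mem hy

theorem coe_extOmegaMul (d : ℕ) (y : ⋀[ℂ]^d (Fin g ⊕ Fin g → ℂ)) :
    (extOmegaMul g d y : ExtAlg g) = extOmega g * y := rfl

theorem extOmegaMul_injective {d : ℕ} (hd : d < g) : Function.Injective (extOmegaMul g d) := by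
  rw [injective_iff_map_eq_zero]
  intro y hy
  exact Subtype.ext (eq_zero_of_extOmega_mul_eq_zero hd y.2 (congrArg Subtype.val hy))

theorem extOmegaMul_exteriorPowerRep (d : ℕ) (x : USp g) (y : ⋀[ℂ]^d (Fin g ⊕ Fin g → ℂ)) :
    extOmegaMul g d (exteriorPowerRep g d x y) =
      exteriorPowerRep g (d + 2) x (extOmegaMul g d y) := by
  refine Subtype.ext ?_
  rw [coe_extOmegaMul, coe_exteriorPowerRep, coe_exteriorPowerRep, coe_extOmegaMul, map_mul,
    extAct_extOmega]

/-- The multiples of the invariant two-form in the `i`-th exterior power. -/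
theorem exists_subrepresentation_extOmega {i : ℕ} (hi : i ≤ g) :
    ∃ R : Subrepresentation (exteriorPowerRep g i),
      Representation.character (V := R.toSubmodule) R.toRepresentation = (if 2 ≤ i then a g (i - 2) else 0) ∧
      ∀ l, l.length + 2 = i → ∀ y : ⋀[ℂ]^i (Fin g ⊕ Fin g → ℂ),
        (y : ExtAlg g) = extOmega g * extProd l → y ∈ R.toSubmodule := by
  by_cases h : 2 ≤ i
  · obtain ⟨d, rfl⟩ := Nat.exists_eq_add_of_le' h
    let R : Subrepresentation (exteriorPowerRep g (d + 2)) :=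
      ⟨LinearMap.range (extOmegaMul g d), by
        rintro x - ⟨y, rfl⟩
        exact ⟨_, extOmegaMul_exteriorPowerRep d x y⟩⟩
    refine ⟨R, ?_, fun l hl y hy => ?_⟩
    · rw [if_pos h, Nat.add_sub_cancel, a_eq_character (by omega)]
      refine (Representation.char_iso (Representation.Equiv.mk
        (LinearEquiv.ofInjective (extOmegaMul g d) (extOmegaMul_injective (by omega)))
        fun x => LinearMap.ext fun y => Subtype.ext ?_)).symm
      exact extOmegaMul_exteriorPowerRep d x y
    · have hl' : extProd l ∈ ⋀[ℂ]^d (Fin g ⊕ Fin g → ℂ) := by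
        rw [← span_extProd]
        exact Submodule.subset_span ⟨l, by omega, rfl⟩
      exact ⟨⟨extProd l, hl'⟩, Subtype.ext hy.symm⟩
  -- In degrees `0` and `1` there are no multiples of `ω`.
  · refine ⟨⊥, ?_, fun l hl => by omega⟩
    rw [if_neg h]
    funext x
    have : Subsingleton (⊥ : Subrepresentation (exteriorPowerRep g i)).toSubmodule :=
      inferInstanceAs (Subsingleton (⊥ : Submodule ℂ (⋀[ℂ]^i (Fin g ⊕ Fin g → ℂ))))
    rw [Representation.character, Subsingleton.elim (Subrepresentation.toRepresentation _ x) 0,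
      map_zero]
    rfl

/-! ### A criterion for irreducibility -/

section Irreducible

variable {V : Type*} [AddCommGroup V] [Module ℂ V] {ρ : Representation ℂ (USp g) V}

/-- The defects of the two components from being weight vectors cancel, so they lie in both summands
and vanish. -/
theorem mem_torusWeightSpace_of_add_mem {A B : Subrepresentation ρ}
    (h : Disjoint A.toSubmodule B.toSubmodule) {u v : V} (hu : u ∈ A.toSubmodule)
    (hv : v ∈ B.toSubmodule) {μ : Weight g}
    (huv : u + v ∈ torusWeightSpace (restrictTorus ρ) μ) :
    v ∈ torusWeightSpace (restrictTorus ρ) μ := by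
  rw [mem_torusWeightSpace] at huv ⊢
  intro z
  have h1 := huv z
  rw [map_add, smul_add] at h1
  have h2 : torusMonomial μ z • u - ρ (torus z) u = ρ (torus z) v - torusMonomial μ z • v := by
    rw [sub_eq_sub_iff_add_eq_add, ← h1, add_comm]
    rfl
  have h3 := Submodule.disjoint_def.mp h _
    (A.toSubmodule.sub_mem (A.toSubmodule.smul_mem _ hu) (A.apply_mem_toSubmodule _ hu))
    (by rw [h2]; exact B.toSubmodule.sub_mem (B.apply_mem_toSubmodule _ hv)
          (B.toSubmodule.smul_mem _ hv))
  rw [h2, sub_eq_zero] at h3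
  exact h3

/-- A representation generated by a vector in a one-dimensional weight space is irreducible. -/
theorem isIrreducible_of_finrank_torusWeightSpace [FiniteDimensional ℂ V]
    (hρ : ρ.HasContinuousCoeffs) {μ : Weight g}
    (hμ : finrank ℂ (torusWeightSpace (restrictTorus ρ) μ) = 1) {b : V}
    (hb : b ∈ torusWeightSpace (restrictTorus ρ) μ)
    (hgen : ∀ A : Subrepresentation ρ, b ∈ A.toSubmodule → A.toSubmodule = ⊤) :
    ρ.IsIrreducible := by
  have hnt : (⊥ : Submodule ℂ V) ≠ ⊤ := by
    intro h
    have h1 : torusWeightSpace (restrictTorus ρ) μ = ⊥ :=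
      le_bot_iff.mp (h ▸ le_top)
    rw [h1, finrank_bot] at hμ
    exact zero_ne_one hμ
  have hb0 : b ≠ 0 := by
    rintro rfl
    exact hnt (hgen ⊥ (Submodule.zero_mem _))
  have : Nontrivial (Subrepresentation ρ) :=
    ⟨⊥, ⊤, fun h => hnt (congrArg Subrepresentation.toSubmodule h)⟩
  refine ⟨fun A => ?_⟩
  obtain ⟨B, hAB⟩ := Representation.exists_isCompl_subrepresentation hρ A
  -- The component `u` of `b` in `A` is a weight vector, hence `c • b`. If `c = 0` then `b` lies in
  -- `B`, so `B` is everything and `A` is zero; otherwise `b` lies in `A`.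
  obtain ⟨u, hu, v, hv, huv⟩ := Submodule.mem_sup.mp
    (hAB.sup_eq_top ▸ Submodule.mem_top : b ∈ A.toSubmodule ⊔ B.toSubmodule)
  have hu' : u ∈ torusWeightSpace (restrictTorus ρ) μ :=
    mem_torusWeightSpace_of_add_mem hAB.disjoint.symm hv hu (by rwa [add_comm, huv])
  obtain ⟨c, hc⟩ := (finrank_eq_one_iff_of_nonzero' (⟨b, hb⟩ : torusWeightSpace _ μ)
    (fun h => hb0 (congrArg Subtype.val h))).mp hμ ⟨u, hu'⟩
  have hc' : c • b = u := congrArg Subtype.val hc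
  by_cases h0 : c = 0
  · left
    have hbv : b = v := by rw [← huv, ← hc', h0, zero_smul, zero_add]
    have hB := hgen B (hbv ▸ hv)
    have h1 := hAB.inf_eq_bot
    rw [hB, inf_top_eq] at h1
    exact Subrepresentation.toSubmodule_injective h1
  · right
    exact Subrepresentation.toSubmodule_injective
      (hgen A ((Submodule.smul_mem_iff _ h0).mp (hc' ▸ hu)))

end Irreducible

/-! ### The fundamental representations -/

variable (g) in
/-- The basis vectors of positive weight that occur in `ϖ_i`. -/
def topIndices (i : ℕ) : List (Fin g) := (Finset.univ.filter fun p : Fin g => p.val < i).toList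

theorem length_topIndices {i : ℕ} (hi : i ≤ g) : (topIndices g i).length = i := by
  rw [topIndices, Finset.length_toList, Fin.card_filter_val_lt, min_eq_right hi]

theorem extAct_torus_topIndices (i : ℕ) (z : Fin g → Circle) :
    extAct (torus z) (extProd ((topIndices g i).map Sum.inl)) =
      torusMonomial (fundamentalWeight g i) z • extProd ((topIndices g i).map Sum.inl) := by
  have h1 : ∀ l : List (Fin g), extAct (torus z) (extProd (l.map Sum.inl)) =
      (l.map fun p => (z p : ℂ)).prod • extProd (l.map Sum.inl) := by
    intro l
    induction l with
    | nil => simp [extProd]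
    | cons p l ih =>
      have h2 : extAct (torus z) (extVec (Sum.inl p)) = (z p : ℂ) • extVec (Sum.inl p) := by
        rw [extAct_extVec, standardRep_single, extVec, ← map_smul]
        congr 1
        funext t
        rw [toMatrix_torus, col_apply, diagonal_apply, Pi.smul_apply, Pi.single_apply]
        split_ifs with h
        · simp [h]
        · simp
      simp only [List.map_cons, extProd_cons, map_mul, ih, h2, List.prod_cons, smul_mul_smul_comm]
  rw [h1, topIndices, Finset.prod_map_toList, torusMonomial_apply, Finset.prod_filter]
  congr 1
  refine Finset.prod_congr rfl fun p _ => ?_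
  rw [fundamentalWeight]
  split_ifs <;> simp

/-- The representation is a complement `B` of the multiples `R` of `ω` in `Λ^i`. The generating
vector is the component `b` in `B` of `e_1 ∧ ⋯ ∧ e_i`. -/
theorem isIrreducibleCharacter_fundChar {i : ℕ} (hi : i ≤ g) :
    IsIrreducibleCharacter g (fundamentalWeight g i) (fundChar g i) := by
  obtain ⟨R, hR, hRω⟩ := exists_subrepresentation_extOmega hi
  have hρ := continuous_exteriorPowerRep (g := g) i
  obtain ⟨B, hRB⟩ := Representation.exists_isCompl_subrepresentation hρ R
  have hB := hρ.subrepresentation B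
  have hchar : Representation.character (V := B.toSubmodule) B.toRepresentation = fundChar g i := by
    rw [fundChar, a_eq_character (by omega), ← hR,
      Representation.character_eq_add_of_isCompl hRB, add_sub_cancel_left]
  have hfin := finrank_torusWeightSpace_fundamentalWeight hB hi hchar
  have hlen := length_topIndices hi
  let e : ⋀[ℂ]^i (Fin g ⊕ Fin g → ℂ) := ⟨extProd ((topIndices g i).map Sum.inl), by
    rw [← span_extProd]
    exact Submodule.subset_span ⟨_, by rw [List.length_map, hlen], rfl⟩⟩
  have he : e ∈ torusWeightSpace (restrictTorus (exteriorPowerRep g i)) (fundamentalWeight g i) := by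
    rw [mem_torusWeightSpace]
    intro z
    refine Subtype.ext ?_
    rw [restrictTorus_apply, coe_exteriorPowerRep]
    exact extAct_torus_topIndices i z
  obtain ⟨r, hr, b, hb, hrb⟩ := Submodule.mem_sup.mp
    (hRB.sup_eq_top ▸ Submodule.mem_top : e ∈ R.toSubmodule ⊔ B.toSubmodule)
  have hbw := mem_torusWeightSpace_of_add_mem hRB.disjoint hr hb (hrb.symm ▸ he)
  rw [mem_torusWeightSpace] at hbw
  refine isIrreducibleCharacter_of_isIrreducible hi hB ?_ hchar
  · refine isIrreducible_of_finrank_torusWeightSpace hB hfin (b := ⟨b, hb⟩) ?_ fun A hA => ?_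
    · rw [mem_torusWeightSpace]
      exact fun z => Subtype.ext (hbw z)
    -- The sum `R + A` contains the multiples of `ω` and the top product, so it is all of `Λ^i` by
    -- `extProd_mem`. As `R` meets `B` trivially, `A` must be `B`.
    · let U : Submodule ℂ (⋀[ℂ]^i (Fin g ⊕ Fin g → ℂ)) :=
        R.toSubmodule ⊔ A.toSubmodule.map B.toSubmodule.subtype
      have hUinv : ∀ x, ∀ y ∈ U, exteriorPowerRep g i x y ∈ U := by
        intro x y hy
        obtain ⟨u, hu, v, hv, rfl⟩ := Submodule.mem_sup.mp hy
        obtain ⟨v, hv, rfl⟩ := hv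
        rw [map_add]
        exact Submodule.add_mem_sup (R.apply_mem_toSubmodule x hu)
          ⟨_, A.apply_mem_toSubmodule x hv, rfl⟩
      have hUtop : U = ⊤ := by
        have h1 := extProd_mem (g := g) (i := i)
          (U := U.map (⋀[ℂ]^i (Fin g ⊕ Fin g → ℂ)).subtype) ?_ ?_
          (S := topIndices g i) (Finset.nodup_toList _) hlen ?_
        · have h2 : ⋀[ℂ]^i (Fin g ⊕ Fin g → ℂ) ≤
              U.map (⋀[ℂ]^i (Fin g ⊕ Fin g → ℂ)).subtype := by
            refine (span_extProd i).ge.trans (Submodule.span_le.mpr ?_)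
            rintro - ⟨l, hl, rfl⟩
            exact h1 l hl
          refine eq_top_iff.mpr fun y _ => ?_
          obtain ⟨y', hy', h3⟩ := h2 y.2
          rwa [Subtype.ext h3] at hy'
        · rintro x - ⟨y, hy, rfl⟩
          exact ⟨_, hUinv x y hy, coe_exteriorPowerRep i x y⟩
        · intro l hl
          have hm : extOmega g * extProd l ∈ ⋀[ℂ]^i (Fin g ⊕ Fin g → ℂ) := by
            rw [← hl]
            refine extOmega_mul_mem ?_
            rw [← span_extProd]
            exact Submodule.subset_span ⟨l, rfl, rfl⟩
          exact ⟨⟨_, hm⟩, Submodule.mem_sup_left (hRω l hl _ rfl), rfl⟩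
        · refine ⟨e, ?_, rfl⟩
          rw [← hrb]
          exact Submodule.add_mem_sup hr ⟨_, hA, rfl⟩
      refine eq_top_iff.mpr fun y _ => ?_
      obtain ⟨u, hu, v, ⟨v, hv, rfl⟩, huv⟩ := Submodule.mem_sup.mp
        (hUtop ▸ Submodule.mem_top : (y : ⋀[ℂ]^i (Fin g ⊕ Fin g → ℂ)) ∈ U)
      have h1 : u = ((y - v : B.toSubmodule) : ⋀[ℂ]^i (Fin g ⊕ Fin g → ℂ)) := by
        rw [Submodule.coe_sub, ← huv]
        simp
      have h2 := Submodule.disjoint_def.mp hRB.disjoint u hu (h1 ▸ Subtype.property _)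
      have h3 : y = v := by
        rw [h2] at h1
        exact sub_eq_zero.mp (Subtype.ext h1.symm)
      rwa [h3]

theorem exists_character_eq_sum_a {V : Type*} [AddCommGroup V] [Module ℂ V]
    {ρ : Representation ℂ (USp g) V} {i : ℕ} (hi : i ≤ g)
    (h : IsIrreducibleOfHighestWeight ρ (fundamentalWeight g i)) :
    ∃ n : ℕ → ℂ, ∀ x, ρ.character x = ∑ j ∈ Finset.range (i + 1), n j * a g j x := by
  have := h.finiteDimensional
  have hm : WeylInvariant (formalCharacter (restrictTorus ρ)) :=
    WeylInvariant.of_classFunction (χ := ρ.character)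
      (fun x y => Representation.char_conj ρ x y) (character_torus h.continuous)
  obtain ⟨n, hn⟩ := hm.exists_eq_sum_extCoeff i _ hi fun μ hμ =>
    hm.isSmallWeight hi (fun ν hν => h.isHighest ν ((isWeight_iff_formalCharacter ρ ν).mpr hν)) hμ
  refine ⟨n, fun x => ?_⟩
  obtain ⟨y, z, rfl⟩ := exists_eq_conj_torus x
  rw [Representation.char_conj, character_torus h.continuous, hn, trigPoly,
    ← Finsupp.sum_finsetSum_index (fun _ => zero_mul _) (fun _ _ _ => add_mul _ _ _)]
  refine Finset.sum_congr rfl fun j hj => ?_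
  rw [Finset.mem_range] at hj
  rw [← trigPoly, trigPoly_smul, a_conj, a_torus (by omega), trigPoly_extCoeff]

theorem character_eq_fundChar {V : Type*} [AddCommGroup V] [Module ℂ V]
    {ρ : Representation ℂ (USp g) V} {i : ℕ} (hi : i ≤ g)
    (h : IsIrreducibleOfHighestWeight ρ (fundamentalWeight g i)) :
    ρ.character = fundChar g i := by
  have := h.finiteDimensional
  have := h.irreducible
  have hρ : ρ.HasContinuousCoeffs := h.continuous
  have hinv : Continuous fun x : USp g => ρ.character x⁻¹ :=
    hρ.continuous_character.comp continuous_inv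
  by_contra hne
  -- Orthogonality to `a_j` follows by induction from `a_j = χ_j + a_{j-2}` and orthogonality to
  -- `χ_j`.
  have hmean : ∀ j, j ≤ i → haarMean (fun x => ρ.character x⁻¹ * a g j x) = 0 := by
    intro j
    induction j using Nat.strong_induction_on with
    | _ j ih =>
      intro hj
      obtain ⟨W, _, _, σ, hσ, hσc⟩ := isIrreducibleCharacter_fundChar (hj.trans hi)
      have := hσ.finiteDimensional
      have := hσ.irreducible
      -- An equivalence would make `ϖ_i` a weight of the representation with character `χ_j`,
      -- forcing `i ≤ j`, so `j = i`, contrary to `hne`.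
      have hempty : IsEmpty (Representation.Equiv ρ σ) := by
        refine ⟨fun φ => hne ?_⟩
        have h1 := (Representation.char_iso φ).trans hσc
        have h2 := (isWeight_iff_formalCharacter ρ _).mp h.isWeight
        rw [formalCharacter_eq_fundCoeff hρ (hj.trans hi) h1] at h2
        have h3 := fundamentalWeight_injOn hi (isSmallWeight_of_fundCoeff_ne_zero h2)
        rw [h1, le_antisymm hj h3]
      have h0 : haarMean (fun x => ρ.character x⁻¹ * fundChar g j x) = 0 := by
        rw [← hσc, Representation.haarMean_character_mul_character_inv hρ hσ.continuous,
          finrank_zero_of_subsingleton, Nat.cast_zero]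
      by_cases h2 : 2 ≤ j
      · have hc : Continuous fun x => ρ.character x⁻¹ * fundChar g j x := by
          rw [← hσc]
          exact hinv.mul (Representation.HasContinuousCoeffs.continuous_character hσ.continuous)
        have h3 := haarMean_add (h := fun x => ρ.character x⁻¹ * a g (j - 2) x) hc (hinv.mul (continuous_a (by omega : j - 2 ≤ 2 * g)))
        rw [h0, ih (j - 2) (by omega) (by omega), add_zero] at h3
        rw [← h3]
        congr 1
        funext x
        rw [fundChar, if_pos h2, Pi.sub_apply]
        ring
      · rwa [fundChar, if_neg h2, sub_zero] at h0
  -- Schur's lemma gives norm one, while the expansion of the character in the `a_j` gives norm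
  -- zero.
  have h1 := Representation.haarMean_character_mul_character_inv hρ hρ
  rw [Representation.IsIrreducible.finrank_intertwiningMap_self, Nat.cast_one] at h1
  obtain ⟨n, hn⟩ := exists_character_eq_sum_a hi h
  have h2 : ∀ x, ρ.character x⁻¹ * ρ.character x =
      ∑ j ∈ Finset.range (i + 1), n j * (ρ.character x⁻¹ * a g j x) := by
    intro x
    rw [hn x, Finset.mul_sum]
    exact Finset.sum_congr rfl fun j _ => by ring
  simp only [h2] at h1
  rw [haarMean_sum] at h1
  · refine one_ne_zero (h1.symm.trans (Finset.sum_eq_zero fun j hj => ?_))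
    rw [Finset.mem_range] at hj
    rw [haarMean_const_mul, hmean j (by omega), mul_zero]
  · intro j hj
    rw [Finset.mem_range] at hj
    exact continuous_const.mul (hinv.mul (continuous_a (by omega)))

theorem isIrreducibleCharacter_iff {i : ℕ} (hi : i ≤ g) (ψ : USp g → ℂ) :
    IsIrreducibleCharacter g (fundamentalWeight g i) ψ ↔ ψ = fundChar g i := by
  constructor
  · rintro ⟨V, _, _, ρ, hρ, rfl⟩
    exact character_eq_fundChar hi hρ
  · rintro rfl
    exact isIrreducibleCharacter_fundChar hi

end USp

end

theorem corollary4p3 (g : ℕ) (hg : 1 ≤ g) :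
    ∃ χ : ℕ → USp g → ℂ,
      (∀ i, i ≤ g → ∀ ψ : USp g → ℂ,
        USp.IsIrreducibleCharacter g (USp.fundamentalWeight g i) ψ ↔ ψ = χ i) ∧
      χ 0 = USp.a g 0 ∧
      χ 1 = USp.a g 1 ∧
      ∀ i, 2 ≤ i → i ≤ g →
        χ i = USp.a g i - USp.a g (i - 2) ∧
        χ i = (USp.exteriorPowerRep g i).character -
          (USp.exteriorPowerRep g (i - 2)).character := by
  refine ⟨USp.fundChar g, fun i hi => USp.isIrreducibleCharacter_iff hi, ?_, ?_, fun i h2 hi => ?_⟩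
  · rw [USp.fundChar, if_neg (by omega), sub_zero]
  · rw [USp.fundChar, if_neg (by omega), sub_zero]
  · have h : USp.fundChar g i = USp.a g i - USp.a g (i - 2) := by rw [USp.fundChar, if_pos h2]
    exact ⟨h, by rw [h, USp.a_eq_character (by omega), USp.a_eq_character (by omega)]⟩
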